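/- Let $\mathbb{S}^2\subset\mathbb{R}^3$ be the round unit sphere, write $\fint f=\frac1{4\pi}\int_{\mathbb{S}^2} f\,\mathrm{d}V$ for averages with respect to the area measure, and $\nabla$ for the (weak) gradient on $\mathbb{S}^2$. Let $$\mathring{\mathcal M}_1=\Big\{u\in H^1(\mathbb{S}^2)\ :\ \int_{\mathbb{S}^2}x_i\,e^{2u}\,\mathrm{d}V=0\ \text{ for } i=1,2,3\Big\},$$ and for $u\in H^1(\mathbb{S}^2)$ let $\Lambda(u)=(\Lambda_{ij}(u))_{1\le i,j\le 3}$ be the matrix $$\Lambda_{ij}(u)=\frac{\int_{\mathbb{S}^2}e^{2u}\left(x_ix_j-\frac13\delta_{ij}\right)\mathrm{d}V}{\int_{\mathbb{S}^2}e^{2u}\,\mathrm{d}V},\qquad \|\Lambda(u)\|=\Big(\sum_{i,j=1}^3\Lambda_{ij}(u)^2\Big)^{1/2}.$$ (1) For every $\alpha\in(1/3,1/2)$ there exists a sequence $\{u_n\}\subset\mathring{\mathcal M}_1$ such that $$\log\fint e^{2u_n}-\alpha\fint|\nabla u_n|^2-2\fint u_n\to+\infty\qquad\text{and}\qquad \|\Lambda(u_n)\|^2\to\frac23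 .$$ (2) For every $\alpha\in(1/4,1/3)$ there exists a sequence $\{u_n\}\subset\mathring{\mathcal M}_1$ such that $$\log\fint e^{2u_n}-\alpha\fint|\nabla u_n|^2-2\fint u_n\to+\infty\qquad\text{and}\qquad \|\Lambda(u_n)\|^2\to\frac16 .$$ -/

import Mathlib

open MeasureTheory Filter Topology
open scoped ContDiff

/-- Euclidean three-space. -/
abbrev E3 : Type := EuclideanSpace ℝ (Fin 3)

/-- The unit sphere of Euclidean three-space. -/
abbrev S2 : Type := Metric.sphere (0 : E3) 1

/-- The area measure of the round unit sphere (its total mass is `4 * π`). -/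
noncomputable abbrev area : Measure S2 := (volume : Measure E3).toSphere

/-- The tangential divergence at a point `x` of the unit sphere of a vector field `X`:
the full divergence minus the normal part `⟪DX(x) x, x⟫`. If `X` is tangent to the sphere along
the sphere, this is the divergence for the round metric, and it depends only on the restriction
of `X` to the sphere. -/
noncomputable def sphereDiv (X : E3 → E3) (x : E3) : ℝ :=
  (∑ i : Fin 3, (fderiv ℝ X x (EuclideanSpace.single i 1)) i) - inner ℝ (fderiv ℝ X x x) x

/-- `G` is a square-integrable weak gradient of `u` on the sphere: it is tangent to the sphere, and
`∫ ⟪G, X⟫ = - ∫ u div X` for every smooth tangent vector field `X`. Smooth tangent vector fields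
on the sphere are the restrictions of smooth vector fields on the ambient space that are tangent
along the sphere. -/
structure IsWeakGradient (u : S2 → ℝ) (G : S2 → E3) : Prop where
  memLp : MemLp G 2 area
  tangent : ∀ᵐ x ∂area, inner ℝ (G x) (x : E3) = 0
  integral_eq : ∀ X : E3 → E3, ContDiff ℝ ∞ X → (∀ x : S2, inner ℝ (X x) (x : E3) = 0) →
    ∫ x, inner ℝ (G x) (X x) ∂area = -∫ x, u x * sphereDiv X x ∂area

/-- The weak gradient is unique up to sets of measure zero. -/
theorem IsWeakGradient.ae_eq {u : S2 → ℝ} {G G' : S2 → E3} (h : IsWeakGradient u G)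
    (h' : IsWeakGradient u G') : G =ᵐ[area] G' := by
  have hI : Integrable G area := h.memLp.integrable one_le_two
  have hI' : Integrable G' area := h'.memLp.integrable one_le_two
  have hemb : MeasurableEmbedding (Subtype.val : S2 → E3) :=
    MeasurableEmbedding.subtype_coe Metric.isClosed_sphere.measurableSet
  have key : ∀ i : Fin 3, ∀ᵐ x ∂area, (G x - G' x) i = 0 := by
    intro i
    set f : S2 → ℝ := fun x => (G x - G' x) i with hf
    have hfI : Integrable f area :=
      (EuclideanSpace.proj (𝕜 := ℝ) i).integrable_comp (hI.sub hI')
    set F : E3 → ℝ := Function.extend Subtype.val f 0 with hF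
    have hFf : ∀ x : S2, F x = f x := fun x => Subtype.val_injective.extend_apply f 0 x
    have hcomp : F ∘ (Subtype.val : S2 → E3) = f := funext hFf
    have hFI : Integrable F (area.map Subtype.val) := by
      rw [hemb.integrable_map_iff, hcomp]; exact hfI
    have h0 : ∀ᵐ y ∂(area.map Subtype.val), F y = 0 := by
      refine ae_eq_zero_of_integral_contDiff_smul_eq_zero hFI.locallyIntegrable ?_
      intro g hg _
      rw [hemb.integral_map]
      let X : E3 → E3 := fun y => g y • (EuclideanSpace.single i (1 : ℝ) - y i • y)
      have hXs : ContDiff ℝ ∞ X := by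
        have hp : ContDiff ℝ ∞ (fun y : E3 => y i) :=
          (EuclideanSpace.proj (𝕜 := ℝ) i).contDiff
        have hq : ContDiff ℝ ∞ (fun y : E3 => y) := contDiff_id
        exact hg.smul (contDiff_const.sub (hp.smul hq))
      have hxx : ∀ x : S2, inner ℝ (x : E3) (x : E3) = 1 := by
        intro x
        rw [real_inner_self_eq_norm_sq, norm_eq_of_mem_sphere]; norm_num
      have hXt : ∀ x : S2, inner ℝ (X x) (x : E3) = 0 := by
        intro x
        simp only [X, real_inner_smul_left, inner_sub_left, hxx]
        simp [EuclideanSpace.inner_single_left]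
      have hGX : ∀ W : S2 → E3, (∀ᵐ x ∂area, inner ℝ (W x) (x : E3) = 0) →
          ∀ᵐ x ∂area, inner ℝ (W x) (X x) = g x * W x i := by
        intro W hW
        filter_upwards [hW] with x hx
        simp only [X, real_inner_smul_right, inner_sub_right, hx]
        simp [EuclideanSpace.inner_single_right]
      have hgb : ∃ C, ∀ x : S2, ‖g x‖ ≤ C := by
        obtain ⟨C, hC⟩ := (isCompact_sphere (0 : E3) 1).exists_bound_of_continuousOn
          hg.continuous.continuousOn
        exact ⟨C, fun x => hC x x.2⟩
      obtain ⟨C, hC⟩ := hgb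
      have hint : ∀ W : S2 → E3, Integrable W area →
          Integrable (fun x : S2 => g x * W x i) area := by
        intro W hW
        refine Integrable.bdd_mul (c := C)
          ((EuclideanSpace.proj (𝕜 := ℝ) i).integrable_comp hW) ?_ (Eventually.of_forall hC)
        exact (hg.continuous.comp continuous_subtype_val).aestronglyMeasurable
      have e1 := h.integral_eq X hXs hXt
      have e2 := h'.integral_eq X hXs hXt
      rw [integral_congr_ae (hGX G h.tangent)] at e1
      rw [integral_congr_ae (hGX G' h'.tangent)] at e2
      have : ∫ x : S2, g x • F x ∂area = ∫ x : S2, (g x * G x i - g x * G' x i) ∂area := by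
        congr 1; funext x
        rw [hFf, hf]; simp [mul_sub]
      rw [this, integral_sub (hint G hI) (hint G' hI'), e1, e2, sub_self]
    have := (hemb.ae_map_iff).1 h0
    filter_upwards [this] with x hx
    rw [hFf] at hx; exact hx
  filter_upwards [ae_all_iff.2 key] with x hx
  rw [← sub_eq_zero]
  ext i
  simpa using hx i

/-- The Sobolev space `H¹` of the round sphere. -/
def MemH1 (u : S2 → ℝ) : Prop :=
  MemLp u 2 area ∧ ∃ G : S2 → E3, IsWeakGradient u G

open Classical in
/-- The weak gradient of `u` (defined up to sets of measure zero; zero if there is none). -/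
noncomputable def weakGradient (u : S2 → ℝ) : S2 → E3 :=
  if h : ∃ G : S2 → E3, IsWeakGradient u G then h.choose else 0

theorem isWeakGradient_weakGradient {u : S2 → ℝ} (hu : MemH1 u) :
    IsWeakGradient u (weakGradient u) := by
  unfold weakGradient
  rw [dif_pos hu.2]
  exact hu.2.choose_spec

/-- The functions `u` in `H¹` such that `e^{2u}` has vanishing first moments. (The integrability
of `e^{2u}` holds for every `u` in `H¹`, by the Moser-Trudinger inequality; it is recorded so that
the integrals are visibly meaningful.) -/
structure MemM1 (u : S2 → ℝ) : Prop where
  memH1 : MemH1 u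
  integrable_exp : Integrable (fun x => Real.exp (2 * u x)) area
  moment_eq_zero : ∀ i : Fin 3, ∫ x : S2, (x : E3) i * Real.exp (2 * u x) ∂area = 0

/-- The matrix of deviations of the second moments of `e^{2u}`. -/
noncomputable def Lambda (u : S2 → ℝ) : Matrix (Fin 3) (Fin 3) ℝ :=
  Matrix.of fun i j =>
    (∫ x : S2, Real.exp (2 * u x) *
      ((x : E3) i * (x : E3) j - 1 / 3 * (if i = j then 1 else 0)) ∂area) /
    ∫ x : S2, Real.exp (2 * u x) ∂area

/-- The Euclidean (Frobenius) norm of a real matrix. -/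
noncomputable def matrixNorm (A : Matrix (Fin 3) (Fin 3) ℝ) : ℝ :=
  Real.sqrt (∑ i, ∑ j, A i j ^ 2)

/-- The quantity `log ⨍ e^{2u} - α ⨍ |∇u|² - 2 ⨍ u`. -/
noncomputable def onofriDeficit (α : ℝ) (u : S2 → ℝ) : ℝ :=
  Real.log (⨍ x, Real.exp (2 * u x) ∂area) - α * (⨍ x, ‖weakGradient u x‖ ^ 2 ∂area)
    - 2 * (⨍ x, u x ∂area)

/-! Fix unit vectors `p i`, `N` in number, with pairwise inner products at most -1/2, and take u =
-∑ log(1 + ε - ⟨x, p i⟩). Each summand is, up to an additive constant, the conformal factor of a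
Möbius map concentrating at `p i`, and ε → 0.

The deficit reduces to three estimates. The average of e^{2u} is at least a constant times 1/ε,
since (1 + ε - t)⁻² has average 1/(ε(2 + ε)). The average of |∇u|² is at most (1 + δ) N log(1/ε) + C
for every δ > 0, because near `p i` the squared gradient is at most 2/(1 + ε - t) up to lower-order
terms. The average of u is bounded above. So the deficit is at least c log(1/ε) + C with c > 0 as
soon as αN < 1 (`onofriDeficit_bubbleSum_ge`).

The measure e^{2u} concentrates at the `p i`: if h ≥ 0 is dominated by the squared distance to each
`p i`, then e^{2u} h has integral O(log(1/ε)), against a total mass of order at least 1/ε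
(`tendsto_integral_exp_bubbleSum_mul_div`). In particular the second moment of any coordinate
vanishing at all the `p i` tends to 0.

Two antipodal points (αN < 1 means α < 1/2) give second moments tending to (0, 0, 1), and an
equilateral triangle on a great circle (α < 1/3) gives (1/2, 1/2, 0). The squared norms of Λ are
then 2/3 and 1/6. Reflections preserving the configuration kill the first moments and the
off-diagonal entries.

The averages come down to integrals on an interval by Archimedes' theorem (`integral_inner_comp`).
That theorem, like the identification of weak gradients, rests on the divergence theorem on the
sphere. -/

/-! ### The divergence theorem on the sphere -/

/-- Integration in polar coordinates of a function that splits into a radial and an angular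
factor. -/
theorem integral_eq_integral_area_mul {F : E3 → ℝ} {c : ℝ → ℝ} {D : S2 → ℝ}
    (h : ∀ r : ℝ, 0 < r → ∀ θ : S2, F (r • (θ : E3)) = c r * D θ) :
    ∫ y, F y = (∫ θ, D θ ∂area) *
      ∫ r : Set.Ioi (0 : ℝ), c r ∂(Measure.volumeIoiPow (Module.finrank ℝ E3 - 1)) := by
  calc
    ∫ y, F y = ∫ y : ({(0 : E3)}ᶜ : Set E3), F y ∂(Measure.comap (↑) (volume : Measure E3)) := by
      rw [integral_subtype_comap (measurableSet_singleton _).compl F, restrict_compl_singleton]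
    _ = ∫ z, D z.1 * c z.2
          ∂(area.prod (Measure.volumeIoiPow (Module.finrank ℝ E3 - 1))) := by
      rw [← (volume : Measure E3).measurePreserving_homeomorphUnitSphereProd.integral_comp
        (Homeomorph.measurableEmbedding _)]
      refine integral_congr_ae (Eventually.of_forall fun y => ?_)
      have hy := h _ (homeomorphUnitSphereProd E3 y).2.2 (homeomorphUnitSphereProd E3 y).1
      dsimp only
      rw [mul_comm, ← hy]
      congr 1
      have h0 : ‖(y : E3)‖ ≠ 0 := norm_ne_zero_iff.2 y.2
      simp [smul_smul, mul_inv_cancel₀ h0]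
    _ = _ := integral_prod_mul (fun θ => D θ) (fun r : Set.Ioi (0 : ℝ) => c r)

theorem hasFDerivAt_norm_of_ne_zero {y : E3} (hy : y ≠ 0) :
    HasFDerivAt (fun x : E3 => ‖x‖) (‖y‖⁻¹ • innerSL ℝ y) y := by
  have h := (hasStrictFDerivAt_norm_sq y).hasFDerivAt.sqrt (by simpa using hy)
  have e : (fun x : E3 => √(‖x‖ ^ 2)) = fun x => ‖x‖ := by
    funext x; exact Real.sqrt_sq (norm_nonneg x)
  rw [e] at h
  refine h.congr_fderiv ?_
  rw [Real.sqrt_sq (norm_nonneg y)]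
  ext v
  have : ‖y‖ ≠ 0 := by simpa using hy
  simp
  field_simp

theorem hasFDerivAt_radial_projection {y : E3} (hy : y ≠ 0) :
    HasFDerivAt (fun x : E3 => ‖x‖⁻¹ • x)
      (‖y‖⁻¹ • (ContinuousLinearMap.id ℝ E3 -
        (innerSL ℝ (‖y‖⁻¹ • y)).smulRight (‖y‖⁻¹ • y))) y := by
  have h0 : ‖y‖ ≠ 0 := by simpa using hy
  have h := ((hasDerivAt_inv h0).comp_hasFDerivAt y (hasFDerivAt_norm_of_ne_zero hy)).smul
    (hasFDerivAt_id y)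
  refine h.congr_fderiv ?_
  ext1 v
  simp [smul_smul, sub_eq_add_neg, innerSL_apply_apply]
  ring_nf

/-- The trace of A(I - x xᵀ). The projection I - x xᵀ enters as the derivative of y ↦ y/|y| at a
unit vector, and this trace is the shape of `sphereDiv`. -/
theorem sum_apply_single_comp_tangential_projection (A : E3 →L[ℝ] E3) (x : E3) :
    ∑ i : Fin 3, (A (EuclideanSpace.single i 1 - inner ℝ x (EuclideanSpace.single i 1) • x)) i =
      (∑ i : Fin 3, (A (EuclideanSpace.single i 1)) i) - inner ℝ (A x) x := by
  simp only [map_sub, map_smul, PiLp.sub_apply, PiLp.smul_apply, Finset.sum_sub_distrib,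
    smul_eq_mul, PiLp.inner_apply (𝕜 := ℝ) (A x) x]
  congr 1
  refine Finset.sum_congr rfl fun i _ => ?_
  simp [EuclideanSpace.inner_single_right]

/-- The divergence of `φ(|y|) X(y / |y|)` for a vector field `X` tangent to the sphere. -/
theorem divergence_radial_extension {X : E3 → E3} {φ : ℝ → ℝ} {r : ℝ} (hr : 0 < r) (θ : S2)
    (hX : DifferentiableAt ℝ X θ) (ht : inner ℝ (X θ) (θ : E3) = 0) (hφ : DifferentiableAt ℝ φ r) :
    ∑ i : Fin 3, (fderiv ℝ (fun y : E3 => φ ‖y‖ • X (‖y‖⁻¹ • y)) (r • (θ : E3))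
      (EuclideanSpace.single i 1)) i = (φ r / r) * sphereDiv X θ := by
  have hn : ‖r • (θ : E3)‖ = r := by
    rw [norm_smul, norm_eq_of_mem_sphere]; simp [abs_of_pos hr]
  have hθ : ‖r • (θ : E3)‖⁻¹ • (r • (θ : E3)) = θ := by
    rw [hn, smul_smul, inv_mul_cancel₀ hr.ne', one_smul]
  have hy : r • (θ : E3) ≠ 0 := by
    rw [← norm_ne_zero_iff, hn]; exact hr.ne'
  have h1 : HasFDerivAt (fun y : E3 => φ ‖y‖) _ (r • (θ : E3)) :=
    HasDerivAt.comp_hasFDerivAt (r • (θ : E3)) (by rw [hn]; exact hφ.hasDerivAt)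
      (hasFDerivAt_norm_of_ne_zero hy)
  have h2 : HasFDerivAt (fun y : E3 => X (‖y‖⁻¹ • y)) _ (r • (θ : E3)) :=
    HasFDerivAt.comp (g := X) (r • (θ : E3)) (by rw [hθ]; exact hX.hasFDerivAt)
      (hasFDerivAt_radial_projection hy)
  have h3 : HasFDerivAt (fun y : E3 => φ ‖y‖ • X (‖y‖⁻¹ • y)) _ (r • (θ : E3)) := h1.smul h2
  rw [h3.fderiv, hθ, hn]
  have key : ∀ i : Fin 3, ((φ r • (fderiv ℝ X θ).comp (r⁻¹ • (ContinuousLinearMap.id ℝ E3 -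
        (innerSL ℝ (θ : E3)).smulRight (θ : E3))) +
      (deriv φ r • r⁻¹ • innerSL ℝ (r • (θ : E3))).smulRight (X θ))
      (EuclideanSpace.single i 1)) i =
      (φ r / r) * (fderiv ℝ X θ (EuclideanSpace.single i 1 -
        inner ℝ (θ : E3) (EuclideanSpace.single i 1) • (θ : E3))) i +
      deriv φ r * (X θ i * (θ : E3) i) := by
    intro i
    simp [EuclideanSpace.inner_single_right]
    field_simp
  have hsum := Finset.sum_congr (rfl : (Finset.univ : Finset (Fin 3)) = Finset.univ)
    fun i _ => key i
  -- The radial derivative of φ is paired with the normal component of X, so tangency removes it.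
  have ht' : ∑ i : Fin 3, X θ i * (θ : E3) i = 0 := by
    rw [← ht, PiLp.inner_apply]
    exact Finset.sum_congr rfl fun i _ => by simp [mul_comm]
  rw [Finset.sum_add_distrib, ← Finset.mul_sum, ← Finset.mul_sum, ht',
    sum_apply_single_comp_tangential_projection, mul_zero, add_zero] at hsum
  exact hsum

theorem contDiffAt_radial_projection {y : E3} (hy : y ≠ 0) {n : WithTop ℕ∞} :
    ContDiffAt ℝ n (fun x : E3 => ‖x‖⁻¹ • x) y :=
  ((contDiffAt_norm ℝ hy).inv (by simpa using hy)).smul contDiffAt_id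

theorem integral_fderiv_apply_eq_zero {f : E3 → ℝ} (hf : ContDiff ℝ 1 f) (hc : HasCompactSupport f)
    (v : E3) : ∫ y, fderiv ℝ f y v = 0 := by
  have hI : Integrable (fun y => fderiv ℝ f y v) :=
    ((hf.continuous_fderiv one_ne_zero).clm_apply continuous_const).integrable_of_hasCompactSupport
      (hc.fderiv_apply ℝ v)
  have h := integral_mul_fderiv_eq_neg_fderiv_mul_of_integrable (μ := (volume : Measure E3))
    (f := fun _ => (1 : ℝ)) (g := f) (v := v) (by simp) (by simpa using hI)
    (by simpa using hf.continuous.integrable_of_hasCompactSupport hc)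
    (fun x _ => differentiableAt_const _) (fun x _ => hf.differentiable one_ne_zero x)
  simpa using h

/-- The divergence theorem on the sphere. -/
theorem integral_sphereDiv_eq_zero {X : E3 → E3} (hX : ∀ x : S2, ContDiffAt ℝ 1 X x)
    (ht : ∀ x : S2, inner ℝ (X x) (x : E3) = 0) : ∫ x, sphereDiv X (x : E3) ∂area = 0 := by
  -- The cutoff lives on 1 ≤ |y| ≤ 3, away from the origin, where y/|y| is singular. The extended
  -- field Y is then C¹ with compact support, and its divergence has integral 0 over space.
  let φ : ContDiffBump (2 : ℝ) := ⟨1 / 2, 1, by norm_num, by norm_num⟩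
  let Y : E3 → E3 := fun y => φ ‖y‖ • X (‖y‖⁻¹ • y)
  have hφ0 : ∀ r : ℝ, r ≤ 1 ∨ 3 ≤ r → φ r = 0 := by
    intro r hr
    apply φ.zero_of_le_dist
    change (1 : ℝ) ≤ dist r 2
    rw [Real.dist_eq]
    rcases hr with hr | hr
    · rw [abs_of_nonpos] <;> linarith
    · rw [abs_of_nonneg] <;> linarith
  have hsupp : ∀ g : E3 → ℝ, (∀ y : E3, φ ‖y‖ = 0 → g y = 0) → HasCompactSupport g := by
    intro g hg
    refine HasCompactSupport.intro (isCompact_closedBall (0 : E3) 3) fun y hy => hg y ?_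
    apply hφ0; right
    simp only [Metric.mem_closedBall, dist_zero_right, not_le] at hy
    exact hy.le
  have hproj : ∀ y : E3, y ≠ 0 → ‖y‖⁻¹ • y ∈ Metric.sphere (0 : E3) 1 := by
    intro y hy
    have : ‖y‖ ≠ 0 := by simpa using hy
    simp [norm_smul, inv_mul_cancel₀ this]
  have hY : ContDiff ℝ 1 Y := by
    rw [contDiff_iff_contDiffAt]
    intro y
    by_cases hy : y = 0
    · have : Y =ᶠ[𝓝 y] fun _ => 0 := by
        filter_upwards [Metric.ball_mem_nhds y one_pos] with z hz
        rw [hy, mem_ball_zero_iff] at hz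
        simp [Y, hφ0 ‖z‖ (Or.inl hz.le)]
      exact contDiffAt_const.congr_of_eventuallyEq this
    · have hx := hX ⟨_, hproj y hy⟩
      exact (φ.contDiff.contDiffAt.comp y (contDiffAt_norm ℝ hy)).smul
        (ContDiffAt.comp (g := X) y hx (contDiffAt_radial_projection hy))
  have hYi : ∀ i : Fin 3, ContDiff ℝ 1 (fun y => Y y i) := fun i =>
    (EuclideanSpace.proj (𝕜 := ℝ) i).contDiff.comp hY
  have hYc : ∀ i : Fin 3, HasCompactSupport (fun y => Y y i) := fun i =>
    hsupp _ fun y hy => by simp [Y, hy]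
  have hfd : ∀ (i : Fin 3) (y v : E3), fderiv ℝ (fun y => Y y i) y v = (fderiv ℝ Y y v) i := by
    intro i y v
    have := ((EuclideanSpace.proj (𝕜 := ℝ) i).hasFDerivAt (x := Y y)).comp y
      (hY.differentiable one_ne_zero y).hasFDerivAt
    change HasFDerivAt (fun y => Y y i) _ y at this
    rw [this.fderiv]; rfl
  have h0 : ∫ y, ∑ i : Fin 3, (fderiv ℝ Y y (EuclideanSpace.single i 1)) i = 0 := by
    rw [integral_finsetSum]
    · refine Finset.sum_eq_zero fun i _ => ?_
      simp_rw [← hfd]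
      exact integral_fderiv_apply_eq_zero (hYi i) (hYc i) _
    · intro i _
      simp_rw [← hfd]
      exact (((hYi i).continuous_fderiv one_ne_zero).clm_apply
        continuous_const).integrable_of_hasCompactSupport ((hYc i).fderiv_apply ℝ _)
  rw [integral_eq_integral_area_mul (c := fun r => φ r / r) (D := fun θ => sphereDiv X θ)] at h0
  -- In polar coordinates the integral factors as the wanted one times a radial one. If the radial
  -- factor vanished, the same formula with angular factor 1 would make the integral of φ(|y|)/|y|
  -- zero, although it is positive.
  · refine (mul_eq_zero.1 h0).resolve_right fun hz => ?_
    have h1 : ∫ y : E3, φ ‖y‖ / ‖y‖ = 0 := by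
      rw [integral_eq_integral_area_mul (c := fun r => φ r / r) (D := fun _ => 1), hz, mul_zero]
      intro r hr θ
      simp [norm_smul, norm_eq_of_mem_sphere, abs_of_pos hr]
    have hcont : Continuous fun y : E3 => φ ‖y‖ / ‖y‖ := by
      rw [continuous_iff_continuousAt]
      intro y
      by_cases hy : y = 0
      · have : (fun y : E3 => φ ‖y‖ / ‖y‖) =ᶠ[𝓝 y] fun _ => 0 := by
          filter_upwards [Metric.ball_mem_nhds y one_pos] with z hz
          rw [hy, mem_ball_zero_iff] at hz
          simp [hφ0 ‖z‖ (Or.inl hz.le)]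
        exact continuousAt_const.congr this.symm
      · exact (φ.continuous.comp continuous_norm).continuousAt.div continuous_norm.continuousAt
          (by simpa using hy)
    have hpos := hcont.integral_pos_of_hasCompactSupport_nonneg_nonzero
      (μ := (volume : Measure E3)) (x := EuclideanSpace.single 0 2)
      (hsupp _ fun y hy => by simp [hy]) (fun y => div_nonneg φ.nonneg (norm_nonneg y))
      (by
        have : φ (2 : ℝ) = 1 := φ.one_of_mem_closedBall (by simp [φ.rIn_pos.le])
        simp [this])
    exact hpos.ne' h1
  · intro r hr θ
    exact divergence_radial_extension hr θ ((hX θ).differentiableAt one_ne_zero) (ht θ)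
      (φ.contDiff.differentiable (n := 1) one_ne_zero r)

/-! ### Invariance of the area under linear isometries -/

/-- A linear isometry as a self-map of the sphere. -/
noncomputable def sphereMap (R : E3 ≃ₗᵢ[ℝ] E3) (x : S2) : S2 := ⟨R x, by simp⟩

@[simp] theorem coe_sphereMap (R : E3 ≃ₗᵢ[ℝ] E3) (x : S2) : (sphereMap R x : E3) = R x := rfl

theorem continuous_sphereMap (R : E3 ≃ₗᵢ[ℝ] E3) : Continuous (sphereMap R) :=
  (R.continuous.comp continuous_subtype_val).subtype_mk _

/-- The area of s is a multiple of the volume of the cone over s; a linear isometry maps cones to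
cones and preserves volume. -/
theorem measurePreserving_sphereMap (R : E3 ≃ₗᵢ[ℝ] E3) :
    MeasurePreserving (sphereMap R) area area := by
  refine ⟨(continuous_sphereMap R).measurable, Measure.ext fun s hs => ?_⟩
  rw [Measure.map_apply (continuous_sphereMap R).measurable hs, Measure.toSphere_apply' _ hs,
    Measure.toSphere_apply' _ ((continuous_sphereMap R).measurable hs)]
  congr 1
  rw [← R.symm.measurePreserving.measure_preimage_equiv (f := R.symm.toMeasurableEquiv)]
  congr 1
  ext y
  simp only [Set.mem_smul, Set.mem_image, Set.mem_preimage]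
  constructor
  · rintro ⟨r, hr, _, ⟨x, hx, rfl⟩, h⟩
    refine ⟨r, hr, _, ⟨_, hx, rfl⟩, ?_⟩
    apply R.symm.injective
    rw [coe_sphereMap, map_smul, R.symm_apply_apply]
    exact h
  · rintro ⟨r, hr, _, ⟨x, hx, rfl⟩, rfl⟩
    refine ⟨r, hr, _, ⟨sphereMap R.symm x, ?_, rfl⟩, ?_⟩
    · convert hx; ext1; simp
    · exact (R.symm.map_smul r (x : E3)).symm

theorem integral_comp_sphereMap (R : E3 ≃ₗᵢ[ℝ] E3) (f : S2 → ℝ) :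
    ∫ x, f (sphereMap R x) ∂area = ∫ x, f x ∂area := by
  refine (measurePreserving_sphereMap R).integral_comp ?_ f
  refine MeasurableEquiv.measurableEmbedding (Homeomorph.toMeasurableEquiv
    ⟨⟨sphereMap R, sphereMap R.symm, fun x => ?_, fun x => ?_⟩, continuous_sphereMap R,
      continuous_sphereMap R.symm⟩)
  · ext1; simp
  · ext1; simp

/-! ### Integrability of continuous functions and weak gradients of C¹ functions -/

theorem Continuous.integrable_area {F : Type*} [NormedAddCommGroup F] {f : S2 → F}
    (hf : Continuous f) : Integrable f area := by
  have : CompactSpace S2 := isCompact_iff_compactSpace.1 (isCompact_sphere (0 : E3) 1)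
  exact hf.integrable_of_hasCompactSupport (HasCompactSupport.of_compactSpace f)

theorem Continuous.memLp_area {F : Type*} [NormedAddCommGroup F] [SecondCountableTopology F]
    {f : S2 → F} (hf : Continuous f) (p : ENNReal) : MemLp f p area := by
  have : CompactSpace S2 := isCompact_iff_compactSpace.1 (isCompact_sphere (0 : E3) 1)
  obtain ⟨C, hC⟩ := isCompact_univ.exists_bound_of_continuousOn hf.continuousOn
  exact MemLp.of_bound hf.aestronglyMeasurable C (Eventually.of_forall fun x => hC x trivial)

theorem sphereDiv_smul {U : E3 → ℝ} {X : E3 → E3} {x : E3} (hU : DifferentiableAt ℝ U x)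
    (hX : DifferentiableAt ℝ X x) (ht : inner ℝ (X x) x = 0) :
    sphereDiv (fun y => U y • X y) x = U x * sphereDiv X x + fderiv ℝ U x (X x) := by
  have h : HasFDerivAt (fun y => U y • X y) _ x := hU.hasFDerivAt.smul hX.hasFDerivAt
  have hXs : X x = ∑ i : Fin 3, X x i • EuclideanSpace.single i (1 : ℝ) := by
    simpa using ((EuclideanSpace.basisFun (Fin 3) ℝ).sum_repr (X x)).symm
  have hs : fderiv ℝ U x (X x) =
      ∑ i : Fin 3, fderiv ℝ U x (EuclideanSpace.single i 1) * X x i := by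
    conv_lhs => rw [hXs]
    rw [map_sum]
    exact Finset.sum_congr rfl fun i _ => by rw [map_smul, smul_eq_mul, mul_comm]
  unfold sphereDiv
  rw [h.fderiv, hs]
  simp only [add_apply, smul_apply,
    ContinuousLinearMap.smulRight_apply, PiLp.add_apply, PiLp.smul_apply, smul_eq_mul,
    Finset.sum_add_distrib, inner_add_left, real_inner_smul_left, ht, ← Finset.mul_sum]
  ring

/-- The pointwise tangential gradient of a function of class `C¹` is its weak gradient. -/
theorem isWeakGradient_of_contDiffAt {U : E3 → ℝ} {G : S2 → E3}
    (hU : ∀ x : S2, ContDiffAt ℝ 1 U x) (hG : Continuous G)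
    (ht : ∀ x : S2, inner ℝ (G x) (x : E3) = 0)
    (hGU : ∀ (x : S2) (v : E3), inner ℝ v (x : E3) = 0 → inner ℝ (G x) v = fderiv ℝ U x v) :
    IsWeakGradient (fun x => U x) G where
  memLp := hG.memLp_area 2
  tangent := Eventually.of_forall ht
  integral_eq X hX hXt := by
    have hX1 : ContDiff ℝ 1 X := hX.of_le (by exact_mod_cast le_top)
    -- The divergence theorem for the field U X, expanded by the product rule, is the integration by
    -- parts formula.
    have h0 := integral_sphereDiv_eq_zero (X := fun y => U y • X y)
      (fun x => (hU x).smul hX1.contDiffAt)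
      (fun x => by rw [real_inner_smul_left, hXt, mul_zero])
    have he : ∀ x : S2, sphereDiv (fun y => U y • X y) x =
        U x * sphereDiv X x + inner ℝ (G x) (X x) := fun x => by
      rw [sphereDiv_smul ((hU x).differentiableAt one_ne_zero)
        (hX1.differentiable one_ne_zero x) (hXt x), hGU x _ (hXt x)]
    simp_rw [he] at h0
    have hUc : Continuous fun x : S2 => U x := continuous_iff_continuousAt.2 fun x =>
      ContinuousAt.comp (g := U) (hU x).continuousAt continuous_subtype_val.continuousAt
    have hXc : Continuous fun x : S2 => X x := hX1.continuous.comp continuous_subtype_val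
    have hDc : Continuous fun x : S2 => fderiv ℝ X x :=
      (hX1.continuous_fderiv one_ne_zero).comp continuous_subtype_val
    have hdiv : Continuous fun x : S2 => sphereDiv X x := by
      unfold sphereDiv
      refine (continuous_finsetSum _ fun i _ => ?_).sub
        ((hDc.clm_apply continuous_subtype_val).inner continuous_subtype_val)
      exact (EuclideanSpace.proj (𝕜 := ℝ) i).continuous.comp (hDc.clm_apply continuous_const)
    have hUd : Continuous fun x : S2 => U x * sphereDiv X x := hUc.mul hdiv
    rw [integral_add hUd.integrable_area (hG.inner hXc).integrable_area] at h0
    linarith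

/-- `weakGradient` is an arbitrary choice; uniqueness almost everywhere lets an explicit gradient
replace it in the energy. -/
theorem average_norm_weakGradient_sq {u : S2 → ℝ} {G : S2 → E3} (hu : MemLp u 2 area)
    (hG : IsWeakGradient u G) :
    ⨍ x, ‖weakGradient u x‖ ^ 2 ∂area = ⨍ x, ‖G x‖ ^ 2 ∂area := by
  have h := (isWeakGradient_weakGradient ⟨hu, G, hG⟩).ae_eq hG
  refine average_congr ?_
  filter_upwards [h] with x hx
  rw [hx]

theorem area_real_univ_pos : 0 < area.real Set.univ := by
  rw [measureReal_def]
  exact ENNReal.toReal_pos (by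
    rw [Ne, Measure.measure_univ_eq_zero]; exact Measure.toSphere_ne_zero _)
    (measure_ne_top _ _)

theorem inner_coe_self (x : S2) : inner ℝ (x : E3) (x : E3) = 1 := by
  rw [real_inner_self_eq_norm_sq, norm_eq_of_mem_sphere]; norm_num

/-! ### Archimedes' theorem, from the moments of a linear coordinate -/

/-- The field is the spherical gradient of ⟨x, p⟩, a spherical harmonic of degree 1 with Laplace
eigenvalue -2. -/
theorem sphereDiv_tangential_const (p : E3) (x : S2) :
    sphereDiv (fun y => p - inner ℝ y p • y) x = -2 * inner ℝ (x : E3) p := by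
  have h : HasFDerivAt (fun y : E3 => p - inner ℝ y p • y)
      (-(inner ℝ (x : E3) p • ContinuousLinearMap.id ℝ E3 +
        (innerSL ℝ p).smulRight (x : E3))) (x : E3) := by
    have h1 : HasFDerivAt (fun y : E3 => inner ℝ y p) (innerSL ℝ p) (x : E3) := by
      have := (innerSL ℝ p).hasFDerivAt (x := (x : E3))
      refine this.congr_of_eventuallyEq (Eventually.of_forall fun y => ?_)
      rw [innerSL_apply_apply, real_inner_comm]
    exact (h1.smul (hasFDerivAt_id (x : E3))).const_sub p
  unfold sphereDiv
  rw [h.fderiv]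
  have hs : ∑ i : Fin 3, p i * (x : E3) i = inner ℝ (x : E3) p := by
    simp [PiLp.inner_apply]
  simp [EuclideanSpace.inner_single_right, inner_add_left, real_inner_smul_left,
    Finset.sum_add_distrib, hs]
  rw [real_inner_comm p]
  ring

theorem continuous_inner_coe (p : E3) : Continuous fun x : S2 => inner ℝ (x : E3) p :=
  continuous_subtype_val.inner continuous_const

/-- With t = ⟨x, p⟩ and |∇t|² = 1 - t², the field t^(k+1) ∇t has divergence (k+1) t^k - (k+3)
t^(k+2), whose integral is 0. The powers of t on [-1, 1] satisfy the same recursion. -/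
theorem integral_inner_pow_recursion {p : E3} (hp : ‖p‖ = 1) (k : ℕ) :
    (k + 3) * ∫ x : S2, inner ℝ (x : E3) p ^ (k + 2) ∂area =
      (k + 1) * ∫ x : S2, inner ℝ (x : E3) p ^ k ∂area := by
  have hU : ContDiff ℝ 1 fun y : E3 => inner ℝ y p ^ (k + 1) :=
    (contDiff_id.inner ℝ contDiff_const).pow _
  have hX : ContDiff ℝ 1 fun y : E3 => p - inner ℝ y p • y :=
    contDiff_const.sub ((contDiff_id.inner ℝ contDiff_const).smul contDiff_id)
  have ht : ∀ x : S2, inner ℝ (p - inner ℝ (x : E3) p • (x : E3)) (x : E3) = 0 := fun x => by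
    rw [inner_sub_left, real_inner_smul_left, inner_coe_self, real_inner_comm]; ring
  have h0 := integral_sphereDiv_eq_zero
    (X := fun y => inner ℝ y p ^ (k + 1) • (p - inner ℝ y p • y))
    (fun x => (hU.smul hX).contDiffAt)
    (fun x => by rw [real_inner_smul_left, ht, mul_zero])
  have he : ∀ x : S2, sphereDiv (fun y => inner ℝ y p ^ (k + 1) • (p - inner ℝ y p • y)) x =
      (k + 1) * inner ℝ (x : E3) p ^ k - (k + 3) * inner ℝ (x : E3) p ^ (k + 2) := fun x => by
    rw [sphereDiv_smul (hU.differentiable one_ne_zero x) (hX.differentiable one_ne_zero x) (ht x),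
      sphereDiv_tangential_const]
    have h1 : HasFDerivAt (fun y : E3 => inner ℝ y p) (innerSL ℝ p) (x : E3) := by
      have := (innerSL ℝ p).hasFDerivAt (x := (x : E3))
      refine this.congr_of_eventuallyEq (Eventually.of_forall fun y => ?_)
      rw [innerSL_apply_apply, real_inner_comm]
    have h2 := h1.pow (k + 1)
    rw [h2.fderiv]
    have hpp : inner ℝ p p = (1 : ℝ) := by rw [real_inner_self_eq_norm_sq, hp]; norm_num
    simp [inner_sub_right, real_inner_smul_right, hp, real_inner_comm p]
    ring
  simp_rw [he] at h0
  have hI : ∀ (c : ℝ) (m : ℕ), Integrable (fun x : S2 => c * inner ℝ (x : E3) p ^ m) area :=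
    fun c m => ((continuous_inner_coe p).pow m).integrable_area.const_mul c
  rw [integral_sub (hI _ _) (hI _ _), integral_const_mul, integral_const_mul] at h0
  linarith

theorem integral_inner_eq_zero (p : E3) : ∫ x : S2, inner ℝ (x : E3) p ∂area = 0 := by
  have hX : ContDiff ℝ 1 fun y : E3 => p - inner ℝ y p • y :=
    contDiff_const.sub ((contDiff_id.inner ℝ contDiff_const).smul contDiff_id)
  have h0 := integral_sphereDiv_eq_zero (X := fun y => p - inner ℝ y p • y)
    (fun x => hX.contDiffAt)
    (fun x => by rw [inner_sub_left, real_inner_smul_left, inner_coe_self, real_inner_comm]; ring)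
  simp_rw [sphereDiv_tangential_const, integral_const_mul] at h0
  linarith

theorem integral_inner_pow {p : E3} (hp : ‖p‖ = 1) (k : ℕ) :
    ∫ x : S2, inner ℝ (x : E3) p ^ k ∂area =
      area.real Set.univ / 2 * ∫ t in (-1 : ℝ)..1, t ^ k := by
  induction k using Nat.twoStepInduction with
  | zero => simp; ring
  | one => simp [integral_inner_eq_zero]
  | more k ih _ =>
    have h := integral_inner_pow_recursion hp k
    rw [ih, integral_pow] at h
    rw [integral_pow]
    have h3 : (k : ℝ) + 3 ≠ 0 := by positivity
    have h1 : (k : ℝ) + 1 ≠ 0 := by positivity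
    apply mul_left_cancel₀ h3
    rw [h]
    push_cast
    have h3' : (k : ℝ) + 2 + 1 ≠ 0 := by positivity
    field_simp
    ring

open Polynomial in
theorem integral_polynomial_inner {p : E3} (hp : ‖p‖ = 1) (q : ℝ[X]) :
    ∫ x : S2, q.eval (inner ℝ (x : E3) p) ∂area =
      area.real Set.univ / 2 * ∫ t in (-1 : ℝ)..1, q.eval t := by
  have hI : ∀ (c : ℝ) (m : ℕ), Integrable (fun x : S2 => c * inner ℝ (x : E3) p ^ m) area :=
    fun c m => ((continuous_inner_coe p).pow m).integrable_area.const_mul c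
  simp_rw [Polynomial.eval_eq_sum_range]
  rw [integral_finsetSum _ fun i _ => hI _ _,
    intervalIntegral.integral_finsetSum fun i _ =>
      Continuous.intervalIntegrable (by fun_prop) _ _, Finset.mul_sum]
  refine Finset.sum_congr rfl fun i _ => ?_
  rw [integral_const_mul, integral_inner_pow hp, intervalIntegral.integral_const_mul]
  ring

theorem inner_mem_Icc {p : E3} (hp : ‖p‖ = 1) (x : S2) :
    inner ℝ (x : E3) p ∈ Set.Icc (-1 : ℝ) 1 := by
  have h := abs_real_inner_le_norm (x : E3) p
  rw [hp, norm_eq_of_mem_sphere, one_mul] at h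
  exact abs_le.1 h

/-- Archimedes' theorem: the projection of the area measure to an axis is uniform. -/
theorem integral_inner_comp {p : E3} (hp : ‖p‖ = 1) {f : ℝ → ℝ}
    (hf : ContinuousOn f (Set.Icc (-1) 1)) :
    ∫ x : S2, f (inner ℝ (x : E3) p) ∂area =
      area.real Set.univ / 2 * ∫ t in (-1 : ℝ)..1, f t := by
  have hA := area_real_univ_pos
  have hc := continuous_inner_coe p
  have hfc : Continuous fun x : S2 => f (inner ℝ (x : E3) p) :=
    hf.comp_continuous hc (inner_mem_Icc hp)
  have hfi : IntervalIntegrable f volume (-1) 1 :=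
    ContinuousOn.intervalIntegrable (by rwa [Set.uIcc_of_le (by norm_num)])
  refine eq_of_forall_dist_le fun δ hδ => ?_
  rw [Real.dist_eq]
  -- The precision is chosen so that replacing f by q costs at most δ/2 on each side of the
  -- identity.
  obtain ⟨q, hq⟩ := exists_polynomial_near_of_continuousOn (-1) 1 f hf
    (δ / (2 * area.real Set.univ)) (by positivity)
  have hqc : Continuous fun x : S2 => q.eval (inner ℝ (x : E3) p) := q.continuous.comp hc
  have e1 : |∫ x : S2, (q.eval (inner ℝ (x : E3) p) - f (inner ℝ (x : E3) p)) ∂area| ≤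
      δ / (2 * area.real Set.univ) * area.real Set.univ := by
    rw [← Real.norm_eq_abs]
    exact norm_integral_le_of_norm_le_const
      (Eventually.of_forall fun x => (hq _ (inner_mem_Icc hp x)).le)
  have e2 : |∫ t in (-1 : ℝ)..1, (q.eval t - f t)| ≤
      δ / (2 * area.real Set.univ) * |1 - (-1)| := by
    rw [← Real.norm_eq_abs]
    refine intervalIntegral.norm_integral_le_of_norm_le_const fun t ht => ?_
    rw [Set.uIoc_of_le (by norm_num)] at ht
    exact (hq t ⟨ht.1.le, ht.2⟩).le
  rw [integral_sub hqc.integrable_area hfc.integrable_area, integral_polynomial_inner hp] at e1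
  rw [intervalIntegral.integral_sub (q.continuous.intervalIntegrable _ _) hfi] at e2
  have e3 : δ / (2 * area.real Set.univ) * area.real Set.univ = δ / 2 := by field_simp
  have e4 : |area.real Set.univ / 2 *
      ((∫ t in (-1 : ℝ)..1, q.eval t) - ∫ t in (-1 : ℝ)..1, f t)| ≤ δ / 2 := by
    rw [abs_mul, abs_of_pos (by positivity)]
    calc _ ≤ area.real Set.univ / 2 * (δ / (2 * area.real Set.univ) * |1 - (-1)|) := by gcongr
      _ = δ / 2 := by
        rw [show |(1 : ℝ) - (-1)| = 2 by norm_num]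
        field_simp
  rw [e3] at e1
  rw [abs_le] at *
  constructor <;> linarith [e1.1, e1.2, e4.1, e4.2]

theorem average_inner_comp {p : E3} (hp : ‖p‖ = 1) {f : ℝ → ℝ}
    (hf : ContinuousOn f (Set.Icc (-1) 1)) :
    ⨍ x : S2, f (inner ℝ (x : E3) p) ∂area = (∫ t in (-1 : ℝ)..1, f t) / 2 := by
  have hA := area_real_univ_pos.ne'
  rw [average_eq, integral_inner_comp hp hf, smul_eq_mul]
  field_simp

theorem Continuous.integrable_average {f : S2 → ℝ} (hf : Continuous f) :
    Integrable f ((area Set.univ)⁻¹ • area) :=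
  hf.integrable_area.to_average

theorem average_mono_of_continuous {f g : S2 → ℝ} (hf : Continuous f) (hg : Continuous g)
    (h : ∀ x, f x ≤ g x) : ⨍ x, f x ∂area ≤ ⨍ x, g x ∂area :=
  integral_mono hf.integrable_average hg.integrable_average h

theorem average_area_const (c : ℝ) : ⨍ _, c ∂area = c := by
  have : NeZero area := ⟨Measure.toSphere_ne_zero (volume : Measure E3)⟩
  exact average_const area c

/-! ### A single bubble: gaps, their averages and their gradients -/

section Bubbles

variable {ι : Type*}

/-- `1 + ε - ⟪y, p i⟫`: on the sphere, it vanishes to second order at `p i` up to `ε`. -/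
noncomputable def gap (p : ι → E3) (ε : ℝ) (i : ι) (y : E3) : ℝ := 1 + ε - inner ℝ y (p i)

variable {p : ι → E3} {ε : ℝ}

theorem le_gap (hp : ∀ i, ‖p i‖ = 1) (i : ι) (x : S2) : ε ≤ gap p ε i x := by
  have := (inner_mem_Icc (hp i) x).2
  unfold gap; linarith

theorem gap_pos (hp : ∀ i, ‖p i‖ = 1) (hε : 0 < ε) (i : ι) (x : S2) : 0 < gap p ε i x :=
  hε.trans_le (le_gap hp i x)

theorem gap_le (hp : ∀ i, ‖p i‖ = 1) (i : ι) (x : S2) : gap p ε i x ≤ 2 + ε := by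
  have := (inner_mem_Icc (hp i) x).1
  unfold gap; linarith

theorem one_le_gap_add_gap (hp : ∀ i, ‖p i‖ = 1)
    (hpp : ∀ i j, i ≠ j → inner ℝ (p i) (p j) ≤ (-1 / 2 : ℝ)) (hε : 0 < ε) {i j : ι} (hij : i ≠ j)
    (x : S2) : 1 ≤ gap p ε i x + gap p ε j x := by
  -- |p i + p j|² = 2 + 2⟨p i, p j⟩ ≤ 1: this is where the bound -1/2 on the inner products is used.
  have h1 : ‖p i + p j‖ ≤ 1 := by
    have h := norm_add_sq_real (p i) (p j)
    rw [hp, hp] at h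
    nlinarith [hpp i j hij, norm_nonneg (p i + p j)]
  have h2 := real_inner_le_norm (x : E3) (p i + p j)
  rw [norm_eq_of_mem_sphere, one_mul, inner_add_right] at h2
  unfold gap
  linarith

/-- At each point, all the gaps but possibly one are bounded below. -/
theorem exists_half_le_gap [Finite ι] [Nonempty ι] (hp : ∀ i, ‖p i‖ = 1)
    (hpp : ∀ i j, i ≠ j → inner ℝ (p i) (p j) ≤ (-1 / 2 : ℝ)) (hε : 0 < ε) (x : S2) :
    ∃ i, ∀ j, j ≠ i → 1 / 2 ≤ gap p ε j x := by
  obtain ⟨i, hi⟩ := Finite.exists_min fun i => gap p ε i x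
  refine ⟨i, fun j hj => ?_⟩
  have := one_le_gap_add_gap hp hpp hε hj x
  linarith [hi j]

theorem continuous_gap (i : ι) : Continuous fun x : S2 => gap p ε i x :=
  continuous_const.sub (continuous_inner_coe (p i))

theorem continuous_gap_inv (hp : ∀ i, ‖p i‖ = 1) (hε : 0 < ε) (i : ι) :
    Continuous fun x : S2 => (gap p ε i x)⁻¹ :=
  (continuous_gap i).inv₀ fun x => (gap_pos hp hε i x).ne'

theorem hasFDerivAt_gap (i : ι) (y : E3) :
    HasFDerivAt (gap p ε i) (-innerSL ℝ (p i)) y := by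
  have h := ((innerSL ℝ (p i)).hasFDerivAt (x := y)).const_sub (1 + ε)
  refine h.congr_of_eventuallyEq (Eventually.of_forall fun z => ?_)
  simp only [gap, innerSL_apply_apply, real_inner_comm]

/-- By Archimedes' theorem the gap is uniformly distributed on [ε, 2 + ε]. -/
theorem average_comp_gap {f : ℝ → ℝ} (hp : ∀ i, ‖p i‖ = 1) (hε : 0 < ε)
    (hf : ContinuousOn f (Set.Ioi 0)) (i : ι) :
    ⨍ x : S2, f (gap p ε i x) ∂area = (∫ s in ε..(2 + ε), f s) / 2 := by
  have h := average_inner_comp (hp i) (f := fun t => f (1 + ε - t))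
    (hf.comp (by fun_prop) fun t ht => by
      have := ht.2
      simp only [Set.mem_Ioi]; linarith)
  unfold gap
  rw [h, intervalIntegral.integral_comp_sub_left (fun t => f t)]
  congr 2 <;> ring

theorem average_gap_inv (hp : ∀ i, ‖p i‖ = 1) (hε : 0 < ε) (i : ι) :
    ⨍ x : S2, (gap p ε i x)⁻¹ ∂area = Real.log ((2 + ε) / ε) / 2 := by
  rw [average_comp_gap hp hε (f := fun s => s⁻¹)
    (continuousOn_inv₀.mono fun s hs => (ne_of_gt hs : s ≠ 0)),
    integral_inv_of_pos hε (by linarith)]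

theorem average_gap_sq_inv (hp : ∀ i, ‖p i‖ = 1) (hε : 0 < ε) (i : ι) :
    ⨍ x : S2, (gap p ε i x ^ 2)⁻¹ ∂area = (ε * (2 + ε))⁻¹ := by
  have hd : ∀ s ∈ Set.uIcc ε (2 + ε), HasDerivAt (fun s : ℝ => -s⁻¹) (s ^ 2)⁻¹ s := by
    intro s hs
    rw [Set.uIcc_of_le (by linarith)] at hs
    simpa using (hasDerivAt_inv (hε.trans_le hs.1).ne').fun_neg
  have hc : ContinuousOn (fun s : ℝ => (s ^ 2)⁻¹) (Set.Ioi 0) :=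
    (continuousOn_pow 2).inv₀ fun s hs => pow_ne_zero 2 (ne_of_gt hs)
  rw [average_comp_gap hp hε (f := fun s => (s ^ 2)⁻¹) hc,
    intervalIntegral.integral_eq_sub_of_hasDerivAt hd]
  · have : 2 + ε ≠ 0 := by positivity
    field_simp
    ring
  · refine (hc.mono fun s hs => ?_).intervalIntegrable
    rw [Set.uIcc_of_le (by linarith)] at hs
    exact hε.trans_le hs.1

theorem neg_one_le_average_log_gap (hp : ∀ i, ‖p i‖ = 1) (hε : 0 < ε) (hε1 : ε ≤ 1) (i : ι) :
    -1 ≤ ⨍ x : S2, Real.log (gap p ε i x) ∂area := by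
  rw [average_comp_gap hp hε (Real.continuousOn_log.mono fun s hs => (ne_of_gt hs : s ≠ 0)),
    integral_log]
  have h1 : 0 ≤ (2 + ε) * Real.log (2 + ε) :=
    mul_nonneg (by linarith) (Real.log_nonneg (by linarith))
  have h2 : ε * Real.log ε ≤ 0 :=
    mul_nonpos_of_nonneg_of_nonpos hε.le (Real.log_nonpos hε.le hε1)
  linarith

/-- The squared length of the tangential part of `p i` is (1 - t)(1 + t) ≤ 2(1 - t), at most twice
the gap. One power of the squared gap in the denominator is thereby cancelled, so the energy grows
only logarithmically. -/
theorem norm_gap_inv_smul_sq_le (hp : ∀ i, ‖p i‖ = 1) (hε : 0 < ε) (i : ι) (x : S2) :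
    ‖(gap p ε i x)⁻¹ • (p i - inner ℝ (x : E3) (p i) • (x : E3))‖ ^ 2 ≤
      2 * (gap p ε i x)⁻¹ := by
  have hs := gap_pos hp hε i x
  have h1 : ‖p i - inner ℝ (x : E3) (p i) • (x : E3)‖ ^ 2 = 1 - inner ℝ (x : E3) (p i) ^ 2 := by
    rw [norm_sub_sq_real, norm_smul, hp, norm_eq_of_mem_sphere, real_inner_smul_right,
      real_inner_comm, Real.norm_eq_abs, mul_one, sq_abs]
    ring
  have h2 : 1 - inner ℝ (x : E3) (p i) ^ 2 ≤ 2 * gap p ε i x := by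
    unfold gap
    nlinarith [inner_mem_Icc (hp i) x |>.1, inner_mem_Icc (hp i) x |>.2]
  rw [norm_smul, mul_pow, h1, norm_inv, Real.norm_eq_abs, abs_of_pos hs]
  calc (gap p ε i x)⁻¹ ^ 2 * (1 - inner ℝ (x : E3) (p i) ^ 2)
      ≤ (gap p ε i x)⁻¹ ^ 2 * (2 * gap p ε i x) := by gcongr
    _ = 2 * (gap p ε i x)⁻¹ := by field_simp

/-! ### Sums of bubbles: mass, concentration and energy -/

variable [Fintype ι]

/-- A function concentrating at the points `p i` as `ε` tends to zero. -/
noncomputable def bubbleSum (p : ι → E3) (ε : ℝ) (y : E3) : ℝ := -∑ i, Real.log (gap p ε i y)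

/-- The tangential gradient of `bubbleSum`. -/
noncomputable def bubbleGrad (p : ι → E3) (ε : ℝ) (x : S2) : E3 :=
  ∑ i, (gap p ε i x)⁻¹ • (p i - inner ℝ (x : E3) (p i) • (x : E3))

theorem exp_two_mul_bubbleSum (hp : ∀ i, ‖p i‖ = 1) (hε : 0 < ε) (x : S2) :
    Real.exp (2 * bubbleSum p ε x) = ∏ i, (gap p ε i x ^ 2)⁻¹ := by
  unfold bubbleSum
  rw [mul_neg, Finset.mul_sum, ← Finset.sum_neg_distrib, Real.exp_sum]
  refine Finset.prod_congr rfl fun i _ => ?_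
  have h := gap_pos hp hε i x
  rw [Real.exp_neg, show 2 * Real.log (gap p ε i x) = Real.log (gap p ε i x ^ 2) by
    rw [Real.log_pow]; norm_num, Real.exp_log (by positivity)]

theorem contDiffAt_bubbleSum (hp : ∀ i, ‖p i‖ = 1) (hε : 0 < ε) (x : S2) :
    ContDiffAt ℝ 1 (bubbleSum p ε) x := by
  refine (ContDiffAt.sum fun i _ => ?_).neg
  exact (contDiff_const.sub (contDiff_id.inner ℝ contDiff_const)).contDiffAt.log
    (gap_pos hp hε i x).ne'

theorem continuous_bubbleSum (hp : ∀ i, ‖p i‖ = 1) (hε : 0 < ε) :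
    Continuous fun x : S2 => bubbleSum p ε x :=
  continuous_iff_continuousAt.2 fun x => ContinuousAt.comp (g := bubbleSum p ε)
    (contDiffAt_bubbleSum hp hε x).continuousAt continuous_subtype_val.continuousAt

theorem continuous_bubbleGrad (hp : ∀ i, ‖p i‖ = 1) (hε : 0 < ε) :
    Continuous (bubbleGrad p ε) :=
  continuous_finsetSum _ fun i _ => (continuous_gap_inv hp hε i).smul
    (continuous_const.sub ((continuous_inner_coe (p i)).smul continuous_subtype_val))

theorem isWeakGradient_bubbleSum (hp : ∀ i, ‖p i‖ = 1) (hε : 0 < ε) :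
    IsWeakGradient (fun x => bubbleSum p ε x) (bubbleGrad p ε) := by
  refine isWeakGradient_of_contDiffAt (contDiffAt_bubbleSum hp hε) (continuous_bubbleGrad hp hε)
    (fun x => ?_) fun x v hv => ?_
  · rw [bubbleGrad, sum_inner]
    refine Finset.sum_eq_zero fun i _ => ?_
    rw [real_inner_smul_left, inner_sub_left, real_inner_smul_left, inner_coe_self,
      real_inner_comm]
    ring
  · have h : HasFDerivAt (bubbleSum p ε) _ (x : E3) :=
      (HasFDerivAt.fun_sum fun i (_ : i ∈ Finset.univ) =>
        (hasFDerivAt_gap (p := p) (ε := ε) i (x : E3)).log (gap_pos hp hε i x).ne').neg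
    rw [h.fderiv, bubbleGrad, sum_inner]
    simp only [neg_apply, sum_apply, smul_apply, innerSL_apply_apply,
      smul_eq_mul, mul_neg, Finset.sum_neg_distrib, neg_neg]
    refine Finset.sum_congr rfl fun i _ => ?_
    rw [real_inner_smul_left, inner_sub_left, real_inner_smul_left, real_inner_comm v (x : E3), hv]
    ring

theorem memH1_bubbleSum (hp : ∀ i, ‖p i‖ = 1) (hε : 0 < ε) :
    MemH1 fun x => bubbleSum p ε x :=
  ⟨(continuous_bubbleSum hp hε).memLp_area 2, _, isWeakGradient_bubbleSum hp hε⟩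

theorem continuous_exp_bubbleSum (hp : ∀ i, ‖p i‖ = 1) (hε : 0 < ε) :
    Continuous fun x : S2 => Real.exp (2 * bubbleSum p ε x) :=
  Real.continuous_exp.comp ((continuous_bubbleSum hp hε).const_mul 2)

/-- A single bubble already carries mass of order 1/ε; every other factor is at least 1/9, since the
gaps are at most 3. -/
theorem le_average_exp_bubbleSum [Nonempty ι] (hp : ∀ i, ‖p i‖ = 1) (hε : 0 < ε) (hε1 : ε ≤ 1) :
    (1 / 9) ^ Fintype.card ι / (3 * ε) ≤ ⨍ x : S2, Real.exp (2 * bubbleSum p ε x) ∂area := by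
  classical
  obtain ⟨i⟩ := ‹Nonempty ι›
  have hle : ∀ x : S2, (1 / 9) ^ Fintype.card ι * (gap p ε i x ^ 2)⁻¹ ≤
      Real.exp (2 * bubbleSum p ε x) := by
    intro x
    have hs : 0 ≤ (gap p ε i x ^ 2)⁻¹ := by positivity
    rw [exp_two_mul_bubbleSum hp hε, ← Finset.mul_prod_erase _ _ (Finset.mem_univ i), mul_comm]
    gcongr
    calc ((1 : ℝ) / 9) ^ Fintype.card ι ≤ (1 / 9) ^ (Finset.univ.erase i).card :=
          pow_le_pow_of_le_one (by norm_num) (by norm_num) (Finset.card_le_univ _)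
      _ = ∏ _j ∈ Finset.univ.erase i, (1 / 9 : ℝ) := by rw [Finset.prod_const]
      _ ≤ _ := by
        refine Finset.prod_le_prod (fun _ _ => by norm_num) fun j _ => ?_
        have h0 := gap_pos hp hε j x
        rw [one_div]
        refine inv_anti₀ (by positivity) ?_
        nlinarith [gap_le (ε := ε) hp j x]
  have hci : Continuous fun x : S2 => (gap p ε i x ^ 2)⁻¹ :=
    ((continuous_gap i).pow 2).inv₀ fun x => pow_ne_zero 2 (gap_pos hp hε i x).ne'
  have h := average_mono_of_continuous (hci.const_mul _) (continuous_exp_bubbleSum hp hε) hle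
  refine le_trans ?_ h
  have : ⨍ x : S2, (1 / 9) ^ Fintype.card ι * (gap p ε i x ^ 2)⁻¹ ∂area =
      (1 / 9) ^ Fintype.card ι * (ε * (2 + ε))⁻¹ := by
    rw [← average_gap_sq_inv hp hε i]
    exact integral_const_mul _ _
  rw [this, div_eq_mul_inv]
  have h3 : ε * (2 + ε) ≤ 3 * ε := by nlinarith
  gcongr

/-- Only one factor of e^{2u} can be large at a given point, the others being at most 4. The bound
on `c` cancels one of the two powers of that gap. -/
theorem exp_bubbleSum_mul_le [Nonempty ι] (hp : ∀ i, ‖p i‖ = 1)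
    (hpp : ∀ i j, i ≠ j → inner ℝ (p i) (p j) ≤ (-1 / 2 : ℝ)) (hε : 0 < ε) (x : S2) {c : ℝ}
    (hc : ∀ i, c ≤ 2 * (1 - inner ℝ (x : E3) (p i))) :
    Real.exp (2 * bubbleSum p ε x) * c ≤ 2 * 4 ^ Fintype.card ι * ∑ i, (gap p ε i x)⁻¹ := by
  classical
  obtain ⟨i, hi⟩ := exists_half_le_gap hp hpp hε x
  have hs := gap_pos hp hε i x
  have hprod : ∏ j ∈ Finset.univ.erase i, (gap p ε j x ^ 2)⁻¹ ≤ 4 ^ Fintype.card ι := by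
    calc ∏ j ∈ Finset.univ.erase i, (gap p ε j x ^ 2)⁻¹ ≤ ∏ _j ∈ Finset.univ.erase i, (4 : ℝ) := by
          refine Finset.prod_le_prod (fun _ _ => by positivity) fun j hj => ?_
          have hj' := hi j (Finset.ne_of_mem_erase hj)
          refine inv_le_of_inv_le₀ (by norm_num) ?_
          nlinarith
      _ = 4 ^ (Finset.univ.erase i).card := by rw [Finset.prod_const]
      _ ≤ _ := pow_le_pow_right₀ (by norm_num) (Finset.card_le_univ _)
  calc Real.exp (2 * bubbleSum p ε x) * c
      ≤ Real.exp (2 * bubbleSum p ε x) * (2 * gap p ε i x) := by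
        gcongr
        refine (hc i).trans ?_
        unfold gap; linarith
    _ = 2 * (∏ j ∈ Finset.univ.erase i, (gap p ε j x ^ 2)⁻¹) * (gap p ε i x)⁻¹ := by
        rw [exp_two_mul_bubbleSum hp hε, ← Finset.mul_prod_erase _ _ (Finset.mem_univ i)]
        field_simp
    _ ≤ 2 * 4 ^ Fintype.card ι * ∑ i, (gap p ε i x)⁻¹ := by
        gcongr
        exact Finset.single_le_sum (f := fun i => (gap p ε i x)⁻¹)
          (fun j _ => (inv_pos.2 (gap_pos hp hε j x)).le) (Finset.mem_univ i)

theorem average_sum_gap_inv (hp : ∀ i, ‖p i‖ = 1) (hε : 0 < ε) (c : ℝ) :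
    ⨍ x : S2, c * ∑ i, (gap p ε i x)⁻¹ ∂area =
      c * (Fintype.card ι * (Real.log ((2 + ε) / ε) / 2)) := by
  have h1 : ⨍ x : S2, ∑ i, (gap p ε i x)⁻¹ ∂area =
      ∑ i, ⨍ x : S2, (gap p ε i x)⁻¹ ∂area :=
    integral_finsetSum _ fun i _ => (continuous_gap_inv hp hε i).integrable_average
  simp only [average_gap_inv hp hε, Finset.sum_const, Finset.card_univ, nsmul_eq_mul] at h1
  rw [← h1]
  exact integral_const_mul _ _

/-- The function `e^{2u}` concentrates where `1 - ⟪x, p i⟫` vanishes for some `i`. -/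
theorem average_exp_bubbleSum_mul_le [Nonempty ι] (hp : ∀ i, ‖p i‖ = 1)
    (hpp : ∀ i j, i ≠ j → inner ℝ (p i) (p j) ≤ (-1 / 2 : ℝ)) (hε : 0 < ε) {h : S2 → ℝ}
    (hc : Continuous h) (hle : ∀ x i, h x ≤ 2 * (1 - inner ℝ (x : E3) (p i))) :
    ⨍ x : S2, Real.exp (2 * bubbleSum p ε x) * h x ∂area ≤
      2 * 4 ^ Fintype.card ι * (Fintype.card ι * (Real.log ((2 + ε) / ε) / 2)) := by
  rw [← average_sum_gap_inv hp hε]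
  exact average_mono_of_continuous ((continuous_exp_bubbleSum hp hε).mul hc)
    ((continuous_finsetSum _ fun i _ => continuous_gap_inv hp hε i).const_mul _)
    fun x => exp_bubbleSum_mul_le hp hpp hε x (hle x)

/-- At each point all bubbles but one have gradient of norm at most 2. Young's inequality absorbs
the cross terms at the price of the factor 1 + δ, so the leading constant of the energy is nearly
that of separate bubbles. -/
theorem norm_bubbleGrad_sq_le [Nonempty ι] (hp : ∀ i, ‖p i‖ = 1)
    (hpp : ∀ i j, i ≠ j → inner ℝ (p i) (p j) ≤ (-1 / 2 : ℝ)) (hε : 0 < ε) {δ : ℝ} (hδ : 0 < δ)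
    (x : S2) :
    ‖bubbleGrad p ε x‖ ^ 2 ≤ 2 * (1 + δ) * ∑ i, (gap p ε i x)⁻¹ +
      (1 + δ⁻¹) * (2 * Fintype.card ι) ^ 2 := by
  classical
  obtain ⟨i, hi⟩ := exists_half_le_gap hp hpp hε x
  set v : ι → E3 := fun i => (gap p ε i x)⁻¹ • (p i - inner ℝ (x : E3) (p i) • (x : E3)) with hv
  have hR : ‖∑ j ∈ Finset.univ.erase i, v j‖ ≤ 2 * Fintype.card ι := by
    calc ‖∑ j ∈ Finset.univ.erase i, v j‖ ≤ ∑ _j ∈ Finset.univ.erase i, (2 : ℝ) := by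
          refine norm_sum_le_of_le _ fun j hj => ?_
          have h1 := norm_gap_inv_smul_sq_le hp hε j x
          have h2 := hi j (Finset.ne_of_mem_erase hj)
          have h3 : (gap p ε j x)⁻¹ ≤ 2 := inv_le_of_inv_le₀ (by norm_num) (by linarith)
          refine abs_le_of_sq_le_sq' (?_ : ‖v j‖ ^ 2 ≤ 2 ^ 2) (by norm_num) |>.2
          exact h1.trans (by linarith)
      _ ≤ 2 * Fintype.card ι := by
          rw [Finset.sum_const, nsmul_eq_mul, mul_comm]
          gcongr
          exact Finset.card_le_univ _
  have hG : ‖bubbleGrad p ε x‖ ≤ ‖v i‖ + 2 * Fintype.card ι := by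
    have : bubbleGrad p ε x = v i + ∑ j ∈ Finset.univ.erase i, v j :=
      (Finset.add_sum_erase _ v (Finset.mem_univ i)).symm
    rw [this]
    exact (norm_add_le _ _).trans (by gcongr)
  have hvi : ‖v i‖ ^ 2 ≤ 2 * ∑ i, (gap p ε i x)⁻¹ := by
    refine (norm_gap_inv_smul_sq_le hp hε i x).trans ?_
    gcongr
    exact Finset.single_le_sum (f := fun i => (gap p ε i x)⁻¹)
      (fun j _ => (inv_pos.2 (gap_pos hp hε j x)).le) (Finset.mem_univ i)
  have hyoung : ∀ a b : ℝ, (a + b) ^ 2 ≤ (1 + δ) * a ^ 2 + (1 + δ⁻¹) * b ^ 2 := by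
    intro a b
    have h : 0 ≤ δ⁻¹ * (δ * a - b) ^ 2 := by positivity
    have e : δ⁻¹ * (δ * a - b) ^ 2 = δ * a ^ 2 - 2 * a * b + δ⁻¹ * b ^ 2 := by
      field_simp; ring
    linarith
  calc ‖bubbleGrad p ε x‖ ^ 2 ≤ (‖v i‖ + 2 * Fintype.card ι) ^ 2 := by gcongr
    _ ≤ (1 + δ) * ‖v i‖ ^ 2 + (1 + δ⁻¹) * (2 * Fintype.card ι) ^ 2 := hyoung _ _
    _ ≤ (1 + δ) * (2 * ∑ i, (gap p ε i x)⁻¹) + (1 + δ⁻¹) * (2 * Fintype.card ι) ^ 2 := by gcongr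
    _ = _ := by ring

theorem average_norm_weakGradient_bubbleSum_le [Nonempty ι] (hp : ∀ i, ‖p i‖ = 1)
    (hpp : ∀ i j, i ≠ j → inner ℝ (p i) (p j) ≤ (-1 / 2 : ℝ)) (hε : 0 < ε) {δ : ℝ} (hδ : 0 < δ) :
    ⨍ x : S2, ‖weakGradient (fun x => bubbleSum p ε x) x‖ ^ 2 ∂area ≤
      (1 + δ) * Fintype.card ι * Real.log ((2 + ε) / ε) +
        (1 + δ⁻¹) * (2 * Fintype.card ι) ^ 2 := by
  rw [average_norm_weakGradient_sq ((continuous_bubbleSum hp hε).memLp_area 2)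
    (isWeakGradient_bubbleSum hp hε)]
  have hc : Continuous fun x : S2 => 2 * (1 + δ) * ∑ i, (gap p ε i x)⁻¹ :=
    (continuous_finsetSum _ fun i _ => continuous_gap_inv hp hε i).const_mul _
  have hc' : Continuous fun x : S2 => 2 * (1 + δ) * ∑ i, (gap p ε i x)⁻¹ +
      (1 + δ⁻¹) * (2 * Fintype.card ι) ^ 2 := hc.add continuous_const
  refine (average_mono_of_continuous ((continuous_bubbleGrad hp hε).norm.pow 2) hc'
    (norm_bubbleGrad_sq_le hp hpp hε hδ)).trans ?_
  have : ⨍ x : S2, (2 * (1 + δ) * ∑ i, (gap p ε i x)⁻¹ +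
      (1 + δ⁻¹) * (2 * Fintype.card ι) ^ 2) ∂area =
      ⨍ x : S2, 2 * (1 + δ) * ∑ i, (gap p ε i x)⁻¹ ∂area +
      ⨍ _, (1 + δ⁻¹) * (2 * Fintype.card ι) ^ 2 ∂area :=
    integral_add hc.integrable_average continuous_const.integrable_average
  rw [this, average_sum_gap_inv hp hε, average_area_const]
  refine le_of_eq ?_
  ring

theorem average_bubbleSum_le (hp : ∀ i, ‖p i‖ = 1) (hε : 0 < ε) (hε1 : ε ≤ 1) :
    ⨍ x : S2, bubbleSum p ε x ∂area ≤ Fintype.card ι := by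
  have h1 : ⨍ x : S2, bubbleSum p ε x ∂area =
      -∑ i, ⨍ x : S2, Real.log (gap p ε i x) ∂area := by
    refine (integral_neg _).trans (congrArg _ (integral_finsetSum _ fun i _ => ?_))
    exact ((continuous_gap i).log fun x => (gap_pos hp hε i x).ne').integrable_average
  have h2 : ∑ _i : ι, (-1 : ℝ) ≤ ∑ i, ⨍ x : S2, Real.log (gap p ε i x) ∂area :=
    Finset.sum_le_sum fun i _ => neg_one_le_average_log_gap hp hε hε1 i
  simp at h2
  linarith

/-! ### Blow-up of the deficit and concentration of the measure -/

theorem onofriDeficit_bubbleSum_ge [Nonempty ι] (hp : ∀ i, ‖p i‖ = 1)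
    (hpp : ∀ i j, i ≠ j → inner ℝ (p i) (p j) ≤ (-1 / 2 : ℝ)) {α : ℝ} (hα : 0 < α)
    (hαι : α * Fintype.card ι < 1) :
    ∃ c C : ℝ, 0 < c ∧ ∀ ε : ℝ, 0 < ε → ε ≤ 1 →
      c * -Real.log ε + C ≤ onofriDeficit α fun x => bubbleSum p ε x := by
  have hN : (0 : ℝ) < Fintype.card ι := by exact_mod_cast Fintype.card_pos
  set N : ℝ := (Fintype.card ι : ℝ) with hNdef
  have hαN : 0 < α * N := mul_pos hα hN
  -- This δ makes the energy coefficient α(1 + δ)N the midpoint of αN and 1, leaving (1 - αN)/2 in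
  -- front of log(1/ε).
  set δ : ℝ := (1 - α * N) / (2 * (α * N)) with hδdef
  have hδ : 0 < δ := div_pos (by linarith) (by positivity)
  have hδ' : α * ((1 + δ) * N) = (1 + α * N) / 2 := by
    rw [hδdef]; field_simp; ring
  refine ⟨(1 - α * N) / 2, Real.log ((1 / 9) ^ Fintype.card ι / 3) - (1 + α * N) / 2 * Real.log 3 -
    α * ((1 + δ⁻¹) * (2 * N) ^ 2) - 2 * N, by linarith, fun ε hε hε1 => ?_⟩
  have h1 := le_average_exp_bubbleSum hp hε hε1
  have h1' : Real.log ((1 / 9) ^ Fintype.card ι / 3) - Real.log ε ≤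
      Real.log (⨍ x : S2, Real.exp (2 * bubbleSum p ε x) ∂area) := by
    rw [← Real.log_div (by positivity) hε.ne', div_div]
    exact Real.log_le_log (by positivity) h1
  have h2 := mul_le_mul_of_nonneg_left
    (average_norm_weakGradient_bubbleSum_le hp hpp hε hδ) hα.le
  have h3 : Real.log ((2 + ε) / ε) ≤ Real.log 3 - Real.log ε := by
    rw [← Real.log_div (by norm_num) hε.ne']
    refine Real.log_le_log (by positivity) ?_
    gcongr
    linarith
  have h4 := average_bubbleSum_le hp hε hε1
  have h5 : α * ((1 + δ) * N * Real.log ((2 + ε) / ε)) ≤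
      (1 + α * N) / 2 * (Real.log 3 - Real.log ε) := by
    rw [← hδ', mul_assoc α]
    gcongr
  unfold onofriDeficit
  rw [← hNdef, mul_add] at h2
  rw [← hNdef] at h4
  linarith

/-- The parameters of the concentrating sequence. -/
noncomputable def scale (n : ℕ) : ℝ := 1 / ((n : ℝ) + 1)

theorem scale_pos (n : ℕ) : 0 < scale n := Nat.one_div_pos_of_nat

theorem scale_le_one (n : ℕ) : scale n ≤ 1 := by
  unfold scale
  rw [div_le_one (by positivity)]
  linarith [(Nat.cast_nonneg n : (0 : ℝ) ≤ n)]

theorem tendsto_scale : Tendsto scale atTop (𝓝[>] 0) :=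
  tendsto_nhdsWithin_iff.2 ⟨tendsto_one_div_add_atTop_nhds_zero_nat,
    Eventually.of_forall scale_pos⟩

theorem tendsto_onofriDeficit_bubbleSum [Nonempty ι] (hp : ∀ i, ‖p i‖ = 1)
    (hpp : ∀ i j, i ≠ j → inner ℝ (p i) (p j) ≤ (-1 / 2 : ℝ)) {α : ℝ} (hα : 0 < α)
    (hαι : α * Fintype.card ι < 1) :
    Tendsto (fun n => onofriDeficit α fun x => bubbleSum p (scale n) x) atTop atTop := by
  obtain ⟨c, C, hc, h⟩ := onofriDeficit_bubbleSum_ge hp hpp hα hαι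
  refine tendsto_atTop_mono (fun n => h _ (scale_pos n) (scale_le_one n)) ?_
  refine tendsto_atTop_add_const_right _ _ (Tendsto.const_mul_atTop hc ?_)
  exact tendsto_neg_atBot_atTop.comp (Real.tendsto_log_nhdsGT_zero.comp tendsto_scale)

theorem tendsto_integral_exp_bubbleSum_mul_div [Nonempty ι] (hp : ∀ i, ‖p i‖ = 1)
    (hpp : ∀ i j, i ≠ j → inner ℝ (p i) (p j) ≤ (-1 / 2 : ℝ)) {h : S2 → ℝ}
    (hc : Continuous h) (h0 : ∀ x, 0 ≤ h x)
    (hle : ∀ x i, h x ≤ 2 * (1 - inner ℝ (x : E3) (p i))) :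
    Tendsto (fun n => (∫ x : S2, Real.exp (2 * bubbleSum p (scale n) x) * h x ∂area) /
      ∫ x : S2, Real.exp (2 * bubbleSum p (scale n) x) ∂area) atTop (𝓝 0) := by
  set K : ℝ := (1 / 9) ^ Fintype.card ι with hK
  have hKpos : 0 < K := by positivity
  set M : ℝ := 2 * 4 ^ Fintype.card ι * Fintype.card ι / 2 with hM
  have hlim : Tendsto (fun ε : ℝ => 3 * M / K * (Real.log 3 * ε - Real.log ε * ε))
      (𝓝[>] 0) (𝓝 0) := by
    have h1 : Tendsto (fun ε : ℝ => Real.log 3 * ε) (𝓝[>] 0) (𝓝 (Real.log 3 * 0)) :=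
      (tendsto_id.mono_left nhdsWithin_le_nhds).const_mul _
    have hlog : Tendsto (fun ε : ℝ => Real.log ε * ε) (𝓝[>] 0) (𝓝 0) := by
      simpa only [Real.rpow_one] using tendsto_log_mul_rpow_nhdsGT_zero zero_lt_one
    have h2 := (h1.sub hlog).const_mul (3 * M / K)
    simpa using h2
  refine squeeze_zero (fun n => ?_) (fun n => ?_) (hlim.comp tendsto_scale)
  · exact div_nonneg (integral_nonneg fun x => mul_nonneg (Real.exp_pos _).le (h0 x))
      (integral_nonneg fun x => (Real.exp_pos _).le)
  · have hε := scale_pos n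
    have hε1 := scale_le_one n
    have hA := area_real_univ_pos
    have e : (∫ x : S2, Real.exp (2 * bubbleSum p (scale n) x) * h x ∂area) /
        ∫ x : S2, Real.exp (2 * bubbleSum p (scale n) x) ∂area =
        (⨍ x : S2, Real.exp (2 * bubbleSum p (scale n) x) * h x ∂area) /
        ⨍ x : S2, Real.exp (2 * bubbleSum p (scale n) x) ∂area := by
      rw [average_eq, average_eq, smul_eq_mul, smul_eq_mul,
        mul_div_mul_left _ _ (inv_ne_zero hA.ne')]
    have h1 := le_average_exp_bubbleSum hp hε hε1
    have h2 := average_exp_bubbleSum_mul_le hp hpp hε hc hle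
    have h3 : Real.log ((2 + scale n) / scale n) ≤ Real.log 3 - Real.log (scale n) := by
      rw [← Real.log_div (by norm_num) hε.ne']
      refine Real.log_le_log (by positivity) ?_
      gcongr
      linarith
    have h4 : 0 ≤ Real.log 3 - Real.log (scale n) := by
      have := Real.log_nonpos hε.le hε1
      have := Real.log_nonneg (by norm_num : (1 : ℝ) ≤ 3)
      linarith
    rw [e]
    calc _ ≤ (M * (Real.log 3 - Real.log (scale n))) / (K / (3 * scale n)) := by
          refine div_le_div₀ (by positivity) (h2.trans ?_) (by positivity) h1
          calc _ = M * Real.log ((2 + scale n) / scale n) := by rw [hM]; ring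
            _ ≤ _ := by gcongr
      _ = 3 * M / K * (Real.log 3 * scale n - Real.log (scale n) * scale n) := by
          field_simp

end Bubbles

/-! ### Reflections and moments of symmetric functions -/

/-- The reflection in the plane orthogonal to `v`. -/
noncomputable def householder (v : E3) : E3 ≃ₗᵢ[ℝ] E3 := (Submodule.span ℝ {v})ᗮ.reflection

theorem householder_apply {v : E3} (hv : ‖v‖ = 1) (y : E3) :
    householder v y = y - (2 * inner ℝ v y) • v := by
  rw [householder, Submodule.reflection_orthogonal_apply, Submodule.reflection_singleton_apply]
  simp only [hv, RCLike.ofReal_real_eq_id, id, one_pow, div_one, ← Nat.cast_smul_eq_nsmul ℝ,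
    smul_smul, Nat.cast_ofNat, neg_sub]

/-- The change of sign of the coordinate `k`. -/
noncomputable def coordFlip (k : Fin 3) : E3 ≃ₗᵢ[ℝ] E3 :=
  householder (EuclideanSpace.single k 1)

theorem coordFlip_apply (k i : Fin 3) (y : E3) :
    coordFlip k y i = if i = k then -y i else y i := by
  rw [coordFlip, householder_apply (by simp)]
  by_cases h : i = k
  · subst h
    simp [EuclideanSpace.inner_single_left]
    ring
  · simp [h]

theorem inner_eq_coord (x y : E3) : inner ℝ x y = x 0 * y 0 + x 1 * y 1 + x 2 * y 2 := by
  simp [PiLp.inner_apply, Fin.sum_univ_three, mul_comm]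

theorem norm_eq_one_of_coord {x : E3} (h : x 0 ^ 2 + x 1 ^ 2 + x 2 ^ 2 = 1) : ‖x‖ = 1 := by
  rw [EuclideanSpace.norm_eq, Fin.sum_univ_three]
  simp [h]

theorem continuous_coord (i : Fin 3) : Continuous fun x : S2 => (x : E3) i :=
  (EuclideanSpace.proj (𝕜 := ℝ) i).continuous.comp continuous_subtype_val

theorem sum_coord_sq (x : S2) : (x : E3) 0 ^ 2 + (x : E3) 1 ^ 2 + (x : E3) 2 ^ 2 = 1 := by
  have h := inner_coe_self x
  rw [inner_eq_coord] at h
  linarith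

/-- The right side is |x - p|², and x k is a coordinate of x - p. -/
theorem coord_sq_le {p : E3} (hp : ‖p‖ = 1) {k : Fin 3} (hk : p k = 0) (x : S2) :
    (x : E3) k ^ 2 ≤ 2 * (1 - inner ℝ (x : E3) p) := by
  have h1 := norm_sub_sq_real (x : E3) p
  rw [hp, norm_eq_of_mem_sphere] at h1
  have h2 := PiLp.norm_apply_le ((x : E3) - p) k
  rw [PiLp.sub_apply, hk, sub_zero] at h2
  have h3 : ‖(x : E3) k‖ ^ 2 ≤ ‖(x : E3) - p‖ ^ 2 := by gcongr
  rw [Real.norm_eq_abs, sq_abs] at h3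
  linarith

theorem integral_exp_mul_comp_sphereMap {u : S2 → ℝ} {R : E3 ≃ₗᵢ[ℝ] E3}
    (hR : ∀ x, u (sphereMap R x) = u x) (h : E3 → ℝ) :
    ∫ x : S2, Real.exp (2 * u x) * h (R x) ∂area = ∫ x : S2, Real.exp (2 * u x) * h x ∂area := by
  rw [← integral_comp_sphereMap R fun x => Real.exp (2 * u x) * h x]
  simp only [hR, coe_sphereMap]

theorem integral_exp_mul_coord_eq_zero {u : S2 → ℝ} {k : Fin 3}
    (hk : ∀ x, u (sphereMap (coordFlip k) x) = u x) :
    ∫ x : S2, Real.exp (2 * u x) * (x : E3) k ∂area = 0 := by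
  have h := integral_exp_mul_comp_sphereMap hk fun y => y k
  simp only [coordFlip_apply, if_true, mul_neg] at h
  rw [integral_neg] at h
  linarith

theorem integral_exp_mul_coord_mul_coord_eq_zero {u : S2 → ℝ} {k i : Fin 3}
    (hk : ∀ x, u (sphereMap (coordFlip k) x) = u x) (hik : i ≠ k) :
    ∫ x : S2, Real.exp (2 * u x) * ((x : E3) i * (x : E3) k) ∂area = 0 := by
  have h := integral_exp_mul_comp_sphereMap hk fun y => y i * y k
  simp only [coordFlip_apply, if_true, if_neg hik, mul_neg] at h
  rw [integral_neg] at h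
  linarith

/-- The normalized second moments of `e^{2u}`. -/
noncomputable def secondMoment (u : S2 → ℝ) (i : Fin 3) : ℝ :=
  (∫ x : S2, Real.exp (2 * u x) * (x : E3) i ^ 2 ∂area) / ∫ x : S2, Real.exp (2 * u x) ∂area

theorem integral_exp_two_mul_pos {u : S2 → ℝ} (hu : Continuous u) :
    0 < ∫ x : S2, Real.exp (2 * u x) ∂area := by
  have : NeZero area := ⟨Measure.toSphere_ne_zero (volume : Measure E3)⟩
  exact integral_exp_pos (f := fun x => 2 * u x)
    (Continuous.integrable_area (Real.continuous_exp.comp (hu.const_mul 2)))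

theorem sum_secondMoment {u : S2 → ℝ} (hu : Continuous u) :
    secondMoment u 0 + secondMoment u 1 + secondMoment u 2 = 1 := by
  have hI : ∀ i : Fin 3, Integrable (fun x : S2 => Real.exp (2 * u x) * (x : E3) i ^ 2) area :=
    fun i => ((Real.continuous_exp.comp (hu.const_mul 2)).mul
      ((continuous_coord i).pow 2)).integrable_area
  unfold secondMoment
  rw [← add_div, ← add_div, ← integral_add (hI 0) (hI 1),
    ← integral_add (f := fun x : S2 => Real.exp (2 * u x) * (x : E3) 0 ^ 2 +
      Real.exp (2 * u x) * (x : E3) 1 ^ 2) ((hI 0).add (hI 1)) (hI 2),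
    div_eq_one_iff_eq (integral_exp_two_mul_pos hu).ne']
  refine integral_congr_ae (Eventually.of_forall fun x => ?_)
  dsimp only
  rw [← mul_add, ← mul_add, sum_coord_sq, mul_one]

theorem Lambda_apply_self {u : S2 → ℝ} (hu : Continuous u) (i : Fin 3) :
    Lambda u i i = secondMoment u i - 1 / 3 := by
  have hE : Continuous fun x : S2 => Real.exp (2 * u x) :=
    Real.continuous_exp.comp (hu.const_mul 2)
  have hI : Integrable (fun x : S2 => Real.exp (2 * u x) * (x : E3) i ^ 2) area :=
    (hE.mul ((continuous_coord i).pow 2)).integrable_area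
  have h := (integral_exp_two_mul_pos hu).ne'
  simp only [Lambda, secondMoment, Matrix.of_apply, if_true, mul_one, mul_sub, ← sq]
  rw [integral_sub hI (hE.integrable_area.mul_const _), integral_mul_const]
  field_simp

/-- Two flips suffice, since every pair of distinct indices contains 1 or 2; the triangle is not
invariant under the flip of coordinate 0. -/
theorem Lambda_apply_of_ne {u : S2 → ℝ} (h1 : ∀ x, u (sphereMap (coordFlip 1) x) = u x)
    (h2 : ∀ x, u (sphereMap (coordFlip 2) x) = u x) {i j : Fin 3} (hij : i ≠ j) :
    Lambda u i j = 0 := by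
  have key : ∀ i k : Fin 3, i ≠ k → (∀ x, u (sphereMap (coordFlip k) x) = u x) →
      Lambda u i k = 0 ∧ Lambda u k i = 0 := by
    intro i k hik hk
    have h := integral_exp_mul_coord_mul_coord_eq_zero hk hik
    constructor
    · simp [Lambda, hik, h]
    · simp_rw [mul_comm _ (_ : ℝ)] at h
      simp [Lambda, hik.symm, mul_comm, h]
  fin_cases i <;> fin_cases j <;> first | exact absurd rfl hij | skip
  · exact (key 0 1 (by decide) h1).1
  · exact (key 0 2 (by decide) h2).1
  · exact (key 0 1 (by decide) h1).2
  · exact (key 1 2 (by decide) h2).1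
  · exact (key 0 2 (by decide) h2).2
  · exact (key 1 2 (by decide) h2).2

theorem matrixNorm_Lambda_sq {u : S2 → ℝ} (hu : Continuous u)
    (h1 : ∀ x, u (sphereMap (coordFlip 1) x) = u x)
    (h2 : ∀ x, u (sphereMap (coordFlip 2) x) = u x) :
    matrixNorm (Lambda u) ^ 2 = (secondMoment u 0 - 1 / 3) ^ 2 + (secondMoment u 1 - 1 / 3) ^ 2 +
      (secondMoment u 2 - 1 / 3) ^ 2 := by
  rw [matrixNorm, Real.sq_sqrt (by positivity), ← Lambda_apply_self hu, ← Lambda_apply_self hu,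
    ← Lambda_apply_self hu]
  have h := @Lambda_apply_of_ne u h1 h2
  simp [Fin.sum_univ_three, h]

theorem tendsto_matrixNorm_Lambda_sq {u : ℕ → S2 → ℝ} (hu : ∀ n, Continuous (u n))
    (h1 : ∀ n x, u n (sphereMap (coordFlip 1) x) = u n x)
    (h2 : ∀ n x, u n (sphereMap (coordFlip 2) x) = u n x) {a b : ℝ}
    (ha : Tendsto (fun n => secondMoment (u n) 0) atTop (𝓝 a))
    (hb : Tendsto (fun n => secondMoment (u n) 1) atTop (𝓝 b)) :
    Tendsto (fun n => matrixNorm (Lambda (u n)) ^ 2) atTop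
      (𝓝 ((a - 1 / 3) ^ 2 + (b - 1 / 3) ^ 2 + (2 / 3 - a - b) ^ 2)) := by
  have he : ∀ n, matrixNorm (Lambda (u n)) ^ 2 = (secondMoment (u n) 0 - 1 / 3) ^ 2 +
      (secondMoment (u n) 1 - 1 / 3) ^ 2 +
      (2 / 3 - secondMoment (u n) 0 - secondMoment (u n) 1) ^ 2 := fun n => by
    rw [matrixNorm_Lambda_sq (hu n) (h1 n) (h2 n),
      -- The second moments sum to 1 on the unit sphere, so two of them determine the third.
      eq_sub_of_add_eq' (sum_secondMoment (hu n))]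
    ring
  simp_rw [he]
  exact (((ha.sub_const _).pow 2).add ((hb.sub_const _).pow 2)).add
    (((ha.const_sub _).sub hb).pow 2)

theorem tendsto_secondMoment_bubbleSum {ι : Type*} [Fintype ι] [Nonempty ι] {p : ι → E3}
    (hp : ∀ i, ‖p i‖ = 1) (hpp : ∀ i j, i ≠ j → inner ℝ (p i) (p j) ≤ (-1 / 2 : ℝ)) {k : Fin 3}
    (hk : ∀ i, p i k = 0) :
    Tendsto (fun n => secondMoment (fun x => bubbleSum p (scale n) x) k) atTop (𝓝 0) :=
  tendsto_integral_exp_bubbleSum_mul_div hp hpp ((continuous_coord k).pow 2)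
    (fun _ => sq_nonneg _) fun x i => coord_sq_le (hp i) (hk i) x

theorem memM1_bubbleSum {ι : Type*} [Fintype ι] {p : ι → E3} (hp : ∀ i, ‖p i‖ = 1) {ε : ℝ}
    (hε : 0 < ε)
    (h0 : ∀ i : Fin 3, ∫ x : S2, Real.exp (2 * bubbleSum p ε x) * (x : E3) i ∂area = 0) :
    MemM1 fun x => bubbleSum p ε x where
  memH1 := memH1_bubbleSum hp hε
  integrable_exp := (continuous_exp_bubbleSum hp hε).integrable_area
  moment_eq_zero i := by simpa only [mul_comm] using h0 i

/-! ### The two configurations: antipodal points and the equilateral triangle -/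

/-- The north and the south pole. -/
noncomputable def poles : Fin 2 → E3 := ![!₂[0, 0, 1], !₂[0, 0, -1]]

theorem norm_poles (i : Fin 2) : ‖poles i‖ = 1 :=
  norm_eq_one_of_coord (by fin_cases i <;> simp [poles])

theorem inner_poles_le (i j : Fin 2) (hij : i ≠ j) :
    inner ℝ (poles i) (poles j) ≤ (-1 / 2 : ℝ) := by
  rw [inner_eq_coord]
  fin_cases i <;> fin_cases j <;> simp [poles] at hij ⊢ <;> norm_num

theorem bubbleSum_poles_coordFlip (ε : ℝ) (k : Fin 3) (y : E3) :
    bubbleSum poles ε (coordFlip k y) = bubbleSum poles ε y := by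
  simp only [bubbleSum, gap, Fin.sum_univ_two, inner_eq_coord, coordFlip_apply]
  fin_cases k <;> simp [poles, add_comm]

/-- The vertices of an equilateral triangle on the equator. -/
noncomputable def triangle : Fin 3 → E3 :=
  ![!₂[1, 0, 0], !₂[-1 / 2, √3 / 2, 0], !₂[-1 / 2, -(√3 / 2), 0]]

theorem sqrt_three_sq : √(3 : ℝ) ^ 2 = 3 := Real.sq_sqrt (by norm_num)

theorem norm_triangle (i : Fin 3) : ‖triangle i‖ = 1 := by
  refine norm_eq_one_of_coord ?_
  fin_cases i <;> simp [triangle, div_pow] <;> norm_num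

theorem inner_triangle_le (i j : Fin 3) (hij : i ≠ j) :
    inner ℝ (triangle i) (triangle j) ≤ (-1 / 2 : ℝ) := by
  have h := sqrt_three_sq
  rw [inner_eq_coord]
  fin_cases i <;> fin_cases j <;> simp [triangle] at hij ⊢ <;> nlinarith

theorem bubbleSum_triangle_coordFlip_one (ε : ℝ) (y : E3) :
    bubbleSum triangle ε (coordFlip 1 y) = bubbleSum triangle ε y := by
  simp only [bubbleSum, gap, Fin.sum_univ_three, inner_eq_coord, coordFlip_apply]
  simp [triangle]
  ring

theorem bubbleSum_triangle_coordFlip_two (ε : ℝ) (y : E3) :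
    bubbleSum triangle ε (coordFlip 2 y) = bubbleSum triangle ε y := by
  simp only [bubbleSum, gap, Fin.sum_univ_three, inner_eq_coord, coordFlip_apply]
  simp [triangle]

/-- The reflection that exchanges the first two vertices of the triangle. -/
noncomputable def triangleFlip : E3 ≃ₗᵢ[ℝ] E3 := householder !₂[√3 / 2, -1 / 2, 0]

theorem triangleFlip_apply (y : E3) :
    triangleFlip y = !₂[-(y 0) / 2 + √3 / 2 * y 1, √3 / 2 * y 0 + y 1 / 2, y 2] := by
  have h := sqrt_three_sq
  rw [triangleFlip, householder_apply (norm_eq_one_of_coord (by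
    simp [div_pow, h]; norm_num)), inner_eq_coord]
  ext i
  fin_cases i
  · simp
    linear_combination (-(1 / 2) * y 0) * h
  · simp
    ring
  · simp

theorem bubbleSum_triangle_triangleFlip (ε : ℝ) (y : E3) :
    bubbleSum triangle ε (triangleFlip y) = bubbleSum triangle ε y := by
  have h := sqrt_three_sq
  have e0 : gap triangle ε 0 (triangleFlip y) = gap triangle ε 1 y := by
    simp [gap, triangleFlip_apply, inner_eq_coord, triangle]
    ring
  have e1 : gap triangle ε 1 (triangleFlip y) = gap triangle ε 0 y := by
    simp [gap, triangleFlip_apply, inner_eq_coord, triangle]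
    linear_combination (1 / 4 * y 0) * h
  have e2 : gap triangle ε 2 (triangleFlip y) = gap triangle ε 2 y := by
    simp [gap, triangleFlip_apply, inner_eq_coord, triangle]
    linear_combination (-(1 / 4) * y 0) * h
  simp only [bubbleSum, Fin.sum_univ_three, e0, e1, e2]
  ring

/-- Coordinate flips handle indices 1 and 2. For index 0, `triangleFlip` gives m₀ = -m₀/2 + (√3/2)
m₁ with m₁ = 0. -/
theorem integral_exp_bubbleSum_triangle_coord {ε : ℝ} (hε : 0 < ε) (i : Fin 3) :
    ∫ x : S2, Real.exp (2 * bubbleSum triangle ε x) * (x : E3) i ∂area = 0 := by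
  have hE := continuous_exp_bubbleSum norm_triangle hε
  have h1 := integral_exp_mul_coord_eq_zero (u := fun x => bubbleSum triangle ε x) (k := 1)
    fun x => bubbleSum_triangle_coordFlip_one ε x
  have h2 := integral_exp_mul_coord_eq_zero (u := fun x => bubbleSum triangle ε x) (k := 2)
    fun x => bubbleSum_triangle_coordFlip_two ε x
  have h0 := integral_exp_mul_comp_sphereMap (u := fun x => bubbleSum triangle ε x)
    (R := triangleFlip) (fun x => bubbleSum_triangle_triangleFlip ε x) fun y => y 0
  have hI : ∀ i : Fin 3, Integrable
      (fun x : S2 => Real.exp (2 * bubbleSum triangle ε x) * (x : E3) i) area :=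
    fun i => (hE.mul (continuous_coord i)).integrable_area
  have he : ∀ x : S2, Real.exp (2 * bubbleSum triangle ε x) * triangleFlip x 0 =
      -(1 / 2) * (Real.exp (2 * bubbleSum triangle ε x) * (x : E3) 0) +
      √3 / 2 * (Real.exp (2 * bubbleSum triangle ε x) * (x : E3) 1) := fun x => by
    rw [triangleFlip_apply]
    simp
    ring
  simp_rw [he] at h0
  rw [integral_add ((hI 0).const_mul _) ((hI 1).const_mul _), integral_const_mul,
    integral_const_mul, h1] at h0
  fin_cases i
  · change ∫ x : S2, Real.exp (2 * bubbleSum triangle ε x) * (x : E3) 0 ∂area = 0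
    linarith
  · exact h1
  · exact h2

/-- Under `triangleFlip`, x₀² becomes x₀²/4 + 3x₁²/4 - (√3/2) x₀x₁, and the mixed moment vanishes by
the flip of coordinate 1. -/
theorem secondMoment_bubbleSum_triangle {ε : ℝ} (hε : 0 < ε) :
    secondMoment (fun x => bubbleSum triangle ε x) 0 =
      secondMoment (fun x => bubbleSum triangle ε x) 1 := by
  have hE := continuous_exp_bubbleSum norm_triangle hε
  have h01 := integral_exp_mul_coord_mul_coord_eq_zero (u := fun x => bubbleSum triangle ε x)
    (k := 1) (i := 0) (fun x => bubbleSum_triangle_coordFlip_one ε x) (by decide)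
  have h0 := integral_exp_mul_comp_sphereMap (u := fun x => bubbleSum triangle ε x)
    (R := triangleFlip) (fun x => bubbleSum_triangle_triangleFlip ε x) fun y => y 0 ^ 2
  have hI : ∀ i j : Fin 3, Integrable
      (fun x : S2 => Real.exp (2 * bubbleSum triangle ε x) * ((x : E3) i * (x : E3) j)) area :=
    fun i j => (hE.mul ((continuous_coord i).mul (continuous_coord j))).integrable_area
  have he : ∀ x : S2, Real.exp (2 * bubbleSum triangle ε x) * triangleFlip x 0 ^ 2 =
      1 / 4 * (Real.exp (2 * bubbleSum triangle ε x) * ((x : E3) 0 * (x : E3) 0)) +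
      3 / 4 * (Real.exp (2 * bubbleSum triangle ε x) * ((x : E3) 1 * (x : E3) 1)) -
      √3 / 2 * (Real.exp (2 * bubbleSum triangle ε x) * ((x : E3) 0 * (x : E3) 1)) := fun x => by
    rw [triangleFlip_apply]
    simp
    linear_combination
      (1 / 4 * Real.exp (2 * bubbleSum triangle ε x) * (x : E3) 1 ^ 2) * sqrt_three_sq
  simp_rw [he] at h0
  have hI3 : Integrable (fun x : S2 =>
      1 / 4 * (Real.exp (2 * bubbleSum triangle ε x) * ((x : E3) 0 * (x : E3) 0)) +
      3 / 4 * (Real.exp (2 * bubbleSum triangle ε x) * ((x : E3) 1 * (x : E3) 1))) area :=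
    ((hI 0 0).const_mul _).add ((hI 1 1).const_mul _)
  rw [integral_sub hI3 ((hI 0 1).const_mul _),
    integral_add ((hI 0 0).const_mul _) ((hI 1 1).const_mul _), integral_const_mul,
    integral_const_mul, integral_const_mul, h01] at h0
  unfold secondMoment
  congr 1
  simp only [sq] at h0 ⊢
  linarith

theorem mainTheorem7 :
    (∀ α : ℝ, 1 / 3 < α → α < 1 / 2 →
      ∃ u : ℕ → S2 → ℝ, (∀ n, MemM1 (u n)) ∧
        Tendsto (fun n => onofriDeficit α (u n)) atTop atTop ∧
        Tendsto (fun n => matrixNorm (Lambda (u n)) ^ 2) atTop (𝓝 (2 / 3))) ∧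
    (∀ α : ℝ, 1 / 4 < α → α < 1 / 3 →
      ∃ u : ℕ → S2 → ℝ, (∀ n, MemM1 (u n)) ∧
        Tendsto (fun n => onofriDeficit α (u n)) atTop atTop ∧
        Tendsto (fun n => matrixNorm (Lambda (u n)) ^ 2) atTop (𝓝 (1 / 6))) := by
  constructor
  · intro α h1 h2
    refine ⟨fun n x => bubbleSum poles (scale n) x, fun n => ?_, ?_, ?_⟩
    · exact memM1_bubbleSum norm_poles (scale_pos n) fun i => integral_exp_mul_coord_eq_zero
        (u := fun x => bubbleSum poles (scale n) x)
        fun x => bubbleSum_poles_coordFlip (scale n) i x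
    · refine tendsto_onofriDeficit_bubbleSum norm_poles inner_poles_le (by linarith) ?_
      rw [Fintype.card_fin]; push_cast; linarith
    · have h := tendsto_matrixNorm_Lambda_sq
        (u := fun n x => bubbleSum poles (scale n) x)
        (fun n => continuous_bubbleSum norm_poles (scale_pos n))
        (fun n x => bubbleSum_poles_coordFlip (scale n) 1 x)
        (fun n x => bubbleSum_poles_coordFlip (scale n) 2 x)
        (tendsto_secondMoment_bubbleSum norm_poles inner_poles_le
          fun i => by fin_cases i <;> simp [poles])
        (tendsto_secondMoment_bubbleSum norm_poles inner_poles_le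
          fun i => by fin_cases i <;> simp [poles])
      convert h using 2
      norm_num
  · intro α h1 h2
    have hc : ∀ n, Continuous fun x : S2 => bubbleSum triangle (scale n) x :=
      fun n => continuous_bubbleSum norm_triangle (scale_pos n)
    refine ⟨fun n x => bubbleSum triangle (scale n) x, fun n => ?_, ?_, ?_⟩
    · exact memM1_bubbleSum norm_triangle (scale_pos n)
        (integral_exp_bubbleSum_triangle_coord (scale_pos n))
    · refine tendsto_onofriDeficit_bubbleSum norm_triangle inner_triangle_le (by linarith) ?_
      rw [Fintype.card_fin]; push_cast; linarith
    · have ht := tendsto_secondMoment_bubbleSum norm_triangle inner_triangle_le (k := 2)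
        fun i => by fin_cases i <;> simp [triangle]
      -- The two equatorial moments are equal and share what the vanishing third moment leaves, so
      -- both tend to 1/2.
      have he : ∀ n, secondMoment (fun x => bubbleSum triangle (scale n) x) 1 =
          (1 - secondMoment (fun x => bubbleSum triangle (scale n) x) 2) / 2 := fun n => by
        have := sum_secondMoment (hc n)
        have := secondMoment_bubbleSum_triangle (scale_pos n)
        linarith
      have h1 : Tendsto (fun n => secondMoment (fun x => bubbleSum triangle (scale n) x) 1)
          atTop (𝓝 ((1 - 0) / 2)) := by
        simp_rw [he]
        exact (ht.const_sub 1).div_const 2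
      have h := tendsto_matrixNorm_Lambda_sq
        (u := fun n x => bubbleSum triangle (scale n) x) hc
        (fun n x => bubbleSum_triangle_coordFlip_one (scale n) x)
        (fun n x => bubbleSum_triangle_coordFlip_two (scale n) x)
        (by simpa only [secondMoment_bubbleSum_triangle (scale_pos _)] using h1) h1
      convert h using 2
      norm_num
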